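/- A \emph{weight} is a sequence $m=(m_n)_{n\ge1}$ of positive real numbers. It is \emph{weakly log-convex} if $n!\,m_n=\mu_1\cdots\mu_n$ for all $n\ge1$ with some sequence $0<\mu_1\le\mu_2\le\cdots$. It is \emph{FdB} (Faà di Bruno) if there is a $\lambda\ge1$ such that \[ m_r\,m_{k_1}\cdots m_{k_r}\le\lambda^{k}m_k,\qquad k=k_1+\dots+k_r, \] for all $r\ge1$ and all $k_1,\dots,k_r\ge1$. A smooth map $f$ from an open set $\Omega\subseteq\mathbb R^s$ to $\mathbb R^q$ is \emph{of class $E^m$} if every point of $\Omega$ has a neighbourhood $U\subseteq\Omega$ and a number $r>0$ such that \[ \sup_{x\in U}\ \sup_{n\ge1}\ \frac1{n!}\,\frac{\|D^nf(x)\|}{m_n}\,r^n<\infty . \] \textbf{Theorem.} Let $m$ be a weakly log-convex weight, and let $s,p,q,d\ge1$ be integers. The following statements are equivalent. \begin{enumerate} \item $m$ is FdB. \item $E^m$ is \emph{composition closed}: if $\Omega\subseteq\mathbb R^s$ and $\Omega'\subseteq\mathbb R^p$ are open, $h:\Omega\to\mathbb R^p$ and $g:\Omega'\to\mathbb R^q$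 are of class $E^m$ and $h(\Omega)\subseteq\Omega'$, then $g\circ h$ is of class $E^m$ on $\Omega$. \item $E^m$ is \emph{inversion closed}: if $\Omega\subseteq\mathbb R^d$ is open, $g:\Omega\to\mathbb R^d$ is of class $E^m$, and $g$ restricts to a smooth diffeomorphism from an open set $W\subseteq\Omega$ onto an open set $V\subseteq\mathbb R^d$, then the local inverse $(g|_W)^{-1}:V\to W$ is of class $E^m$. \end{enumerate} In particular, whether (2) or (3) holds does not depend on the positive dimensions $s,p,q,d$. -/

import Mathlib

open scoped ContDiff Topology

/-- A weight is a sequence `m 1, m 2, …` of positive reals; the value `m 0` is never used.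
It is weakly log-convex if `n! * m n = μ 1 * ⋯ * μ n` for all `n ≥ 1`, where
`0 < μ 1 ≤ μ 2 ≤ ⋯`. (In particular `m n > 0` for `n ≥ 1`.) -/
def WeaklyLogConvex (m : ℕ → ℝ) : Prop :=
  ∃ μ : ℕ → ℝ, 0 < μ 1 ∧ (∀ n, 1 ≤ n → μ n ≤ μ (n + 1)) ∧
    ∀ n, 1 ≤ n → (n.factorial : ℝ) * m n = ∏ j ∈ Finset.Icc 1 n, μ j

/-- The Faà di Bruno property of a weight. -/
def IsFdB (m : ℕ → ℝ) : Prop :=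
  ∃ l : ℝ, 1 ≤ l ∧ ∀ r : ℕ, 1 ≤ r → ∀ k : Fin r → ℕ, (∀ i, 1 ≤ k i) →
    m r * ∏ i, m (k i) ≤ l ^ (∑ i, k i) * m (∑ i, k i)

/-- `f` is of class `E^m` on the open set `Ω ⊆ ℝ^s`: it is smooth there, and each point of `Ω`
has a neighbourhood `U` and an `r > 0` such that `‖D^n f (x)‖ r^n / (n! m n)` is bounded
uniformly in `x ∈ U` and `n ≥ 1`. -/
def IsClassE (m : ℕ → ℝ) {s q : ℕ}
    (f : EuclideanSpace ℝ (Fin s) → EuclideanSpace ℝ (Fin q))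
    (Ω : Set (EuclideanSpace ℝ (Fin s))) : Prop :=
  ContDiffOn ℝ ∞ f Ω ∧
    ∀ a ∈ Ω, ∃ U ∈ 𝓝 a, U ⊆ Ω ∧ ∃ r : ℝ, 0 < r ∧ ∃ C : ℝ, ∀ x ∈ U, ∀ n : ℕ, 1 ≤ n →
      1 / (n.factorial : ℝ) * (‖iteratedFDeriv ℝ n f x‖ / m n) * r ^ n ≤ C

/-- `E^m` is closed under the compositions `g ∘ h` of maps `h` from open subsets of `ℝ^s` to
`ℝ^p` with maps `g` from open subsets of `ℝ^p` to `ℝ^q`. -/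
def CompositionClosed (m : ℕ → ℝ) (s p q : ℕ) : Prop :=
  ∀ (Ω : Set (EuclideanSpace ℝ (Fin s))) (Ω' : Set (EuclideanSpace ℝ (Fin p)))
    (h : EuclideanSpace ℝ (Fin s) → EuclideanSpace ℝ (Fin p))
    (g : EuclideanSpace ℝ (Fin p) → EuclideanSpace ℝ (Fin q)),
    IsOpen Ω → IsOpen Ω' → Set.MapsTo h Ω Ω' →
    IsClassE m h Ω → IsClassE m g Ω' → IsClassE m (g ∘ h) Ω

/-- `E^m` is closed under the inversion of local diffeomorphisms of `ℝ^d`: whenever `g` is of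
class `E^m` on an open set `Ω` and restricts to a smooth diffeomorphism `e` (with smooth inverse)
from an open set `e.source ⊆ Ω` onto an open set `e.target`, this local inverse `e.symm` is of
class `E^m` on `e.target`. -/
def InversionClosed (m : ℕ → ℝ) (d : ℕ) : Prop :=
  ∀ (Ω : Set (EuclideanSpace ℝ (Fin d)))
    (g : EuclideanSpace ℝ (Fin d) → EuclideanSpace ℝ (Fin d))
    (e : OpenPartialHomeomorph (EuclideanSpace ℝ (Fin d)) (EuclideanSpace ℝ (Fin d))),
    IsOpen Ω → IsClassE m g Ω → e.source ⊆ Ω → Set.EqOn e g e.source →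
    ContDiffOn ℝ ∞ e.symm e.target → IsClassE m e.symm e.target

/-! The Faà di Bruno formula writes the `n`-th derivative of `g ∘ h` as a sum over partitions of
products of one derivative of `g` of order `r` and derivatives of `h` of orders `k i` with sum `n`.
The FdB inequality bounds each product of weights by `l ^ n * m n`. What remains is the sum of `r! *
∏ (k i)!`, at most `n! * 4 ^ n` by a generating function estimate. This gives composition
closedness.

For inverses, FdB is first turned into a statement about roots: `(m n) ^ (1 / (n - 1))` is
increasing up to a bounded factor. Hence, for each order `N`, the weights up to `N` lie below a
geometric sequence of ratio `L` with `L ^ (N - 1)` comparable to `m N` up to `A ^ N`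
(`HasGeometricMajorants`). Inversion at order `N` then becomes the classical majorant argument for
analytic maps, with constants independent of `N` (`norm_iteratedFDeriv_localInverse_le`).

Conversely, a weighted sum of sines yields a function `H` obeying the `E^m` bounds whose odd
derivatives at `0` are nearly extremal and alternate in sign, the even ones vanishing
(`WeaklyLogConvex.exists_characteristic`). These signs make all terms in the Faà di Bruno formula
for `H ∘ H` equal in sign, so nothing cancels and every single term is bounded by the derivative of
the composition. The same happens for the inverse of `x - ψ x`, where `ψ` is `H` without its linear
part. Either closedness thus gives FdB for odd indices. Weak log-convexity compares roots at nearby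
indices, so the odd case already forces almost increasing roots, and these give back full FdB. -/

open Polynomial Finset

/-! ### Partition sums as coefficients of composed polynomials -/

theorem Polynomial.iteratedDeriv_eval (p : ℝ[X]) (n : ℕ) :
    iteratedDeriv n (fun x => p.eval x) = fun x => (derivative^[n] p).eval x := by
  induction n generalizing p with
  | zero => simp
  | succ n ih =>
    rw [iteratedDeriv_succ']
    have : deriv (fun x => p.eval x) = fun x => (derivative p).eval x := by
      ext x; exact p.deriv
    rw [this, ih, Function.iterate_succ_apply]

theorem Polynomial.iteratedDeriv_eval_zero (p : ℝ[X]) (n : ℕ) :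
    iteratedDeriv n (fun x => p.eval x) 0 = n.factorial * p.coeff n := by
  rw [iteratedDeriv_eval]
  simp only
  rw [← coeff_zero_eq_eval_zero, coeff_iterate_derivative]
  simp [Nat.descFactorial_self]

/-- The truncated exponential generating function `∑_{k=1}^N a k / k! X^k`. -/
noncomputable def expPoly (N : ℕ) (a : ℕ → ℝ) : ℝ[X] :=
  ∑ k ∈ Icc 1 N, C (a k / k.factorial) * X ^ k

theorem coeff_expPoly (N : ℕ) (a : ℕ → ℝ) (n : ℕ) :
    (expPoly N a).coeff n = if n ∈ Icc 1 N then a n / n.factorial else 0 := by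
  simp only [expPoly, finsetSum_coeff, coeff_C_mul, coeff_X_pow, mul_ite, mul_one, mul_zero]
  rw [Finset.sum_ite_eq]

theorem coeff_expPoly_of_mem {N : ℕ} (a : ℕ → ℝ) {n : ℕ} (h1 : 1 ≤ n) (h2 : n ≤ N) :
    (expPoly N a).coeff n = a n / n.factorial := by
  rw [coeff_expPoly, if_pos (Finset.mem_Icc.2 ⟨h1, h2⟩)]

theorem eval_expPoly (N : ℕ) (a : ℕ → ℝ) (t : ℝ) :
    (expPoly N a).eval t = ∑ k ∈ Icc 1 N, a k / k.factorial * t ^ k := by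
  simp [expPoly, eval_finsetSum]

theorem coeff_expPoly_nonneg {N : ℕ} {a : ℕ → ℝ} (ha : ∀ k, 0 ≤ a k) (n : ℕ) :
    0 ≤ (expPoly N a).coeff n := by
  rw [coeff_expPoly]
  split_ifs
  · have := ha n; positivity
  · exact le_rfl

theorem OrderedFinpartition.sum_partSize {n : ℕ} (c : OrderedFinpartition n) :
    ∑ j, c.partSize j = n := by
  simpa using Fintype.card_congr c.equivSigma

theorem OrderedFinpartition.partSize_lt {n : ℕ} (c : OrderedFinpartition n) (h : 2 ≤ c.length)
    (j : Fin c.length) : c.partSize j < n := by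
  have h1 := c.sum_partSize
  have : ∃ i : Fin c.length, i ≠ j := by
    have : Nontrivial (Fin c.length) := Fin.nontrivial_iff_two_le.2 h
    exact exists_ne j
  obtain ⟨i, hi⟩ := this
  have h2 : ∑ x ∈ {i, j}, c.partSize x ≤ ∑ j, c.partSize j :=
    Finset.sum_le_sum_of_subset (Finset.subset_univ _)
  rw [Finset.sum_pair hi] at h2
  have := c.partSize_pos i
  omega

theorem Polynomial.contDiff_eval (p : ℝ[X]) {n : ℕ∞ω} : ContDiff ℝ n fun x => p.eval x := by
  simpa only [coe_aeval_eq_eval] using p.contDiff_aeval (𝕜 := ℝ) n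

/-- This is the Faà di Bruno formula at `0` for two polynomials with prescribed derivatives there.
Truncation at `N ≥ n` does not affect the coefficient of order `n`. -/
theorem sum_orderedFinpartition_eq (a b : ℕ → ℝ) {n N : ℕ} (hn : 1 ≤ n) (hN : n ≤ N) :
    ∑ c : OrderedFinpartition n, a c.length * ∏ j, b (c.partSize j) =
      n.factorial * ((expPoly N a).comp (expPoly N b)).coeff n := by
  have key : ∀ (a : ℕ → ℝ) (k : ℕ), 1 ≤ k → k ≤ N →
      iteratedDeriv k (fun x => (expPoly N a).eval x) 0 = a k := fun a k h1 h2 => by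
    rw [iteratedDeriv_eval_zero, coeff_expPoly_of_mem a h1 h2]
    field_simp
  have h0 : (expPoly N b).eval 0 = 0 := by
    rw [← coeff_zero_eq_eval_zero, coeff_expPoly]; simp
  rw [← iteratedDeriv_eval_zero]
  have hcomp : (fun x => ((expPoly N a).comp (expPoly N b)).eval x) =
      (fun x => (expPoly N a).eval x) ∘ (fun x => (expPoly N b).eval x) := by
    ext x; simp
  rw [hcomp, iteratedDeriv_comp_eq_sum_orderedFinpartition (n := ∞)
    (contDiff_eval _).contDiffAt (contDiff_eval _).contDiffAt (by exact_mod_cast le_top)]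
  refine Finset.sum_congr rfl fun c _ => ?_
  simp only [h0]
  rw [key a _ (c.length_pos (by omega)) (c.length_le.trans hN)]
  congr 1
  exact Finset.prod_congr rfl fun j _ =>
    (key b _ (c.partSize_pos j) ((c.partSize_le j).trans hN)).symm

theorem Polynomial.coeff_mul_nonneg {p q : ℝ[X]} (hp : ∀ n, 0 ≤ p.coeff n)
    (hq : ∀ n, 0 ≤ q.coeff n) (n : ℕ) : 0 ≤ (p * q).coeff n := by
  rw [coeff_mul]
  exact Finset.sum_nonneg fun x _ => mul_nonneg (hp _) (hq _)

theorem Polynomial.coeff_pow_nonneg {p : ℝ[X]} (hp : ∀ n, 0 ≤ p.coeff n) (r n : ℕ) :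
    0 ≤ (p ^ r).coeff n := by
  induction r generalizing n with
  | zero => rw [pow_zero, coeff_one]; split_ifs <;> norm_num
  | succ r ih => rw [pow_succ]; exact coeff_mul_nonneg ih hp n

theorem Polynomial.prod_coeff_le_coeff_pow {p : ℝ[X]} (hp : ∀ n, 0 ≤ p.coeff n) (r : ℕ)
    (k : Fin r → ℕ) : ∏ i, p.coeff (k i) ≤ (p ^ r).coeff (∑ i, k i) := by
  induction r with
  | zero => simp
  | succ r ih =>
    rw [Fin.prod_univ_succ, Fin.sum_univ_succ, pow_succ', coeff_mul]
    refine le_trans (mul_le_mul_of_nonneg_left (ih fun i => k i.succ) (hp _)) ?_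
    exact Finset.single_le_sum (f := fun x : ℕ × ℕ => p.coeff x.1 * (p ^ r).coeff x.2)
      (fun x _ => mul_nonneg (hp _) (coeff_pow_nonneg hp _ _))
      (a := (k 0, ∑ i : Fin r, k i.succ)) (by simp)

theorem Polynomial.coeff_comp_eq_sum (p q : ℝ[X]) (n : ℕ) :
    (p.comp q).coeff n = ∑ r ∈ p.support, p.coeff r * (q ^ r).coeff n := by
  simp [comp_eq_sum_left, Polynomial.sum]

theorem Polynomial.coeff_comp_nonneg {p q : ℝ[X]} (hp : ∀ n, 0 ≤ p.coeff n)
    (hq : ∀ n, 0 ≤ q.coeff n) (n : ℕ) : 0 ≤ (p.comp q).coeff n := by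
  rw [coeff_comp_eq_sum]
  exact Finset.sum_nonneg fun r _ => mul_nonneg (hp r) (coeff_pow_nonneg hq r n)

theorem Polynomial.coeff_mul_prod_coeff_le_coeff_comp {p q : ℝ[X]} (hp : ∀ n, 0 ≤ p.coeff n)
    (hq : ∀ n, 0 ≤ q.coeff n) (r : ℕ) (k : Fin r → ℕ) :
    p.coeff r * ∏ i, q.coeff (k i) ≤ (p.comp q).coeff (∑ i, k i) := by
  rw [coeff_comp_eq_sum]
  refine (mul_le_mul_of_nonneg_left (prod_coeff_le_coeff_pow hq r k) (hp r)).trans ?_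
  by_cases hr : r ∈ p.support
  · exact Finset.single_le_sum (f := fun r => p.coeff r * (q ^ r).coeff (∑ i, k i))
      (fun r _ => mul_nonneg (hp r) (coeff_pow_nonneg hq r _)) hr
  · rw [notMem_support_iff.1 hr, zero_mul]
    exact Finset.sum_nonneg fun r _ => mul_nonneg (hp r) (coeff_pow_nonneg hq r _)

theorem Polynomial.sum_coeff_mul_pow_le_eval {p : ℝ[X]} (hp : ∀ n, 0 ≤ p.coeff n) {t : ℝ}
    (ht : 0 ≤ t) (s : Finset ℕ) : ∑ n ∈ s, p.coeff n * t ^ n ≤ p.eval t := by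
  rw [eval_eq_sum, Polynomial.sum]
  have h1 : ∑ n ∈ s, p.coeff n * t ^ n ≤ ∑ n ∈ s ∪ p.support, p.coeff n * t ^ n :=
    Finset.sum_le_sum_of_subset_of_nonneg Finset.subset_union_left
      fun n _ _ => mul_nonneg (hp n) (pow_nonneg ht n)
  refine h1.trans_eq (Finset.sum_subset Finset.subset_union_right fun n _ hn => ?_).symm
  rw [notMem_support_iff.1 hn, zero_mul]

/-- With nonnegative coefficients, one product picked from the expansion of the composition is at
most the whole coefficient. The converse implications use it to isolate a single FdB term. -/
theorem le_sum_orderedFinpartition {a b : ℕ → ℝ} (ha : ∀ k, 0 ≤ a k) (hb : ∀ k, 0 ≤ b k)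
    {r : ℕ} (hr : 1 ≤ r) (k : Fin r → ℕ) (hk : ∀ i, 1 ≤ k i) :
    (∑ i, k i).factorial * (a r / r.factorial * ∏ i, b (k i) / (k i).factorial) ≤
      ∑ c : OrderedFinpartition (∑ i, k i), a c.length * ∏ j, b (c.partSize j) := by
  have hrn : r ≤ ∑ i, k i := by
    have := Finset.sum_le_sum fun i (_ : i ∈ (univ : Finset (Fin r))) => hk i
    simpa using this
  rw [sum_orderedFinpartition_eq a b (hr.trans hrn) le_rfl]
  have := coeff_mul_prod_coeff_le_coeff_comp (coeff_expPoly_nonneg (N := ∑ i, k i) ha)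
    (coeff_expPoly_nonneg (N := ∑ i, k i) hb) r k
  rw [coeff_expPoly_of_mem a hr hrn] at this
  refine mul_le_mul_of_nonneg_left (le_trans (le_of_eq ?_) this) (by positivity)
  congr 1
  refine Finset.prod_congr rfl fun i _ => ?_
  rw [coeff_expPoly_of_mem b (hk i) (Finset.single_le_sum (fun _ _ => Nat.zero_le _)
    (Finset.mem_univ i))]

theorem sum_sum_orderedFinpartition_le {a b : ℕ → ℝ} (ha : ∀ k, 0 ≤ a k) (hb : ∀ k, 0 ≤ b k)
    (N : ℕ) {t : ℝ} (ht : 0 ≤ t) :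
    ∑ n ∈ Icc 1 N, (∑ c : OrderedFinpartition n, a c.length * ∏ j, b (c.partSize j)) /
      n.factorial * t ^ n ≤ (expPoly N a).eval ((expPoly N b).eval t) := by
  rw [← eval_comp]
  refine le_trans (le_of_eq ?_) (sum_coeff_mul_pow_le_eval (coeff_comp_nonneg
    (coeff_expPoly_nonneg (N := N) ha) (coeff_expPoly_nonneg (N := N) hb)) ht (Icc 1 N))
  refine Finset.sum_congr rfl fun n hn => ?_
  rw [Finset.mem_Icc] at hn
  rw [sum_orderedFinpartition_eq a b hn.1 hn.2]
  field_simp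

/-! ### Geometric estimates for composition and inversion -/

theorem sum_Icc_geometric_le {x : ℝ} (h0 : 0 ≤ x) (h1 : x < 1) (m N : ℕ) :
    ∑ k ∈ Icc m N, x ^ k ≤ x ^ m / (1 - x) := by
  rw [← Finset.Ico_add_one_right_eq_Icc]
  exact geom_sum_Ico_le_of_lt_one h0 h1

theorem sum_orderedFinpartition_factorial_le (n : ℕ) :
    ∑ c : OrderedFinpartition n, (c.length.factorial : ℝ) * ∏ j, ((c.partSize j).factorial : ℝ) ≤
      n.factorial * 4 ^ n := by
  rcases Nat.eq_zero_or_pos n with rfl | hn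
  · simp
  have hnn : ∀ k : ℕ, (0 : ℝ) ≤ (k.factorial : ℝ) := fun k => by positivity
  have heval : ∀ s : ℝ, (expPoly n fun k => (k.factorial : ℝ)).eval s = ∑ k ∈ Icc 1 n, s ^ k :=
    fun s => by
      rw [eval_expPoly]
      refine Finset.sum_congr rfl fun k _ => ?_
      rw [div_self (by positivity), one_mul]
  -- At `1 / 4` the inner geometric sum is at most `1 / 3`, so the outer one is at most `1 / 2`;
  -- each coefficient is then at most `4 ^ n`.
  have h1 := sum_sum_orderedFinpartition_le hnn hnn n (t := 1 / 4) (by norm_num)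
  rw [heval, heval] at h1
  set s := ∑ k ∈ Icc 1 n, (1 / 4 : ℝ) ^ k with hs
  have hs0 : 0 ≤ s := by positivity
  have hs1 : s ≤ 1 / 3 := by
    refine (sum_Icc_geometric_le (by norm_num) (by norm_num) 1 n).trans ?_
    norm_num
  have h2 : ∑ k ∈ Icc 1 n, s ^ k ≤ 1 := by
    refine (sum_Icc_geometric_le hs0 (by linarith) 1 n).trans ?_
    rw [pow_one, div_le_one (by linarith)]
    linarith
  have h3 := (Finset.single_le_sum (f := fun n : ℕ => (∑ c : OrderedFinpartition n,
    (c.length.factorial : ℝ) * ∏ j, ((c.partSize j).factorial : ℝ)) /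
      n.factorial * (1 / 4 : ℝ) ^ n) (fun k _ => by positivity)
      (Finset.mem_Icc.2 ⟨hn, le_refl n⟩)).trans (h1.trans h2)
  simp only [one_div, inv_pow] at h3
  rwa [← div_eq_mul_inv, div_div, div_le_one (by positivity)] at h3

/-- As `a 1 = 0` removes the partition with one block, all remaining blocks are smaller than `n`.
This makes the later identities genuine recursions. -/
theorem sum_orderedFinpartition_congr_of_lt {a b b' : ℕ → ℝ} (ha : a 1 = 0) {n : ℕ} (hn : 1 ≤ n)
    (hb : ∀ k < n, b k = b' k) :
    ∑ c : OrderedFinpartition n, a c.length * ∏ j, b (c.partSize j) =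
      ∑ c : OrderedFinpartition n, a c.length * ∏ j, b' (c.partSize j) := by
  refine Finset.sum_congr rfl fun c _ => ?_
  by_cases hc : c.length = 1
  · have hz : a c.length = 0 := by rw [hc, ha]
    rw [hz, zero_mul, zero_mul]
  · have := c.length_pos hn
    congr 1
    exact Finset.prod_congr rfl fun j _ => hb _ (c.partSize_lt (by omega) j)

/-- A sequence satisfying the recursive inequality of the Taylor coefficients of the inverse of
a perturbation of the identity grows at most geometrically, after division by factorials. -/
theorem le_of_le_sum_orderedFinpartition {a X : ℕ → ℝ} {B C σ : ℝ} {N₀ : ℕ} (hB : 0 < B)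
    (hC : 0 ≤ C) (hσ : 0 < σ) (ha0 : ∀ k, 0 ≤ a k) (hX0 : ∀ k, 0 ≤ X k) (ha1 : a 1 = 0)
    (ha : ∀ r, 2 ≤ r → r ≤ N₀ → a r ≤ C * r.factorial * σ ^ (r - 1)) (hX1 : X 1 ≤ B)
    (hX : ∀ n, 2 ≤ n → n ≤ N₀ →
      X n ≤ ∑ c : OrderedFinpartition n, a c.length * ∏ j, X (c.partSize j))
    {N : ℕ} (hN : 1 ≤ N) (hN₀ : N ≤ N₀) :
    X N ≤ N.factorial * ((2 * B) ^ N * (2 * (C + 1) * σ) ^ (N - 1)) := by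
  -- The value `s` is small enough that the series of `a` at `s` is at most `s / 2`. With `t = s /
  -- (2 * B)` the linear term `B * t` is also `s / 2`, so the bound `s` on the partial sums of `X`
  -- at `t` reproduces itself.
  obtain ⟨s, hs⟩ : ∃ s : ℝ, s = 1 / (2 * (C + 1) * σ) := ⟨_, rfl⟩
  have hs0 : 0 < s := by rw [hs]; positivity
  have hσs : σ * s = 1 / (2 * (C + 1)) := by rw [hs]; field_simp
  have hσs0 : 0 < σ * s := by positivity
  have hσs1 : σ * s ≤ 1 / 2 := by
    rw [hσs]
    exact one_div_le_one_div_of_le (by norm_num) (by linarith)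
  have hCσs : C * (σ * s) ≤ (1 - σ * s) / 2 := by
    rw [hσs]
    field_simp
    linarith
  obtain ⟨t, ht⟩ : ∃ t : ℝ, t = s / (2 * B) := ⟨_, rfl⟩
  have ht0 : 0 < t := by rw [ht]; positivity
  have hBt : B * t = s / 2 := by rw [ht]; field_simp
  have hA : ∀ M, M ≤ N₀ → (expPoly M a).eval s ≤ s / 2 := by
    intro M hM
    rw [eval_expPoly]
    have h1 : ∑ k ∈ Icc 1 M, a k / k.factorial * s ^ k ≤
        ∑ k ∈ Icc 1 M, if k = 1 then 0 else C * s * (σ * s) ^ (k - 1) := by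
      refine Finset.sum_le_sum fun k hk => ?_
      rw [Finset.mem_Icc] at hk
      split_ifs with h
      · rw [h, ha1]; simp
      · have h2 := ha k (by omega) (hk.2.trans hM)
        obtain ⟨l, rfl⟩ : ∃ l, k = l + 1 := ⟨k - 1, by omega⟩
        rw [Nat.add_sub_cancel] at h2 ⊢
        calc a (l + 1) / (l + 1).factorial * s ^ (l + 1)
            ≤ (C * (l + 1).factorial * σ ^ l) / (l + 1).factorial * s ^ (l + 1) := by gcongr
          _ = C * s * (σ * s) ^ l := by field_simp; ring
    have h2 : ∑ k ∈ Icc 1 M, (if k = 1 then 0 else C * s * (σ * s) ^ (k - 1)) ≤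
        C * s * ((σ * s) ^ 1 / (1 - σ * s)) := by
      have : ∑ k ∈ Icc 1 M, (if k = 1 then 0 else C * s * (σ * s) ^ (k - 1)) ≤
          C * s * ∑ k ∈ Icc 1 M, (σ * s) ^ k := by
        rw [Finset.mul_sum]
        rcases Nat.eq_zero_or_pos M with rfl | hM
        · simp
        obtain ⟨M, rfl⟩ : ∃ l, M = l + 1 := ⟨M - 1, by omega⟩
        rw [← Finset.Ico_add_one_right_eq_Icc, Finset.sum_Ico_eq_sum_range,
          Finset.sum_Ico_eq_sum_range, Nat.add_sub_cancel, Finset.sum_range_succ',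
          Finset.sum_range_succ]
        have : (0 : ℝ) ≤ C * s * (σ * s) ^ (1 + M) := by positivity
        refine le_trans (le_of_eq ?_) (le_add_of_nonneg_right this)
        simp only [add_zero, if_true]
        refine Finset.sum_congr rfl fun k _ => ?_
        rw [if_neg (by omega)]
        congr 2
      exact this.trans (mul_le_mul_of_nonneg_left
        (sum_Icc_geometric_le hσs0.le (by linarith) 1 M) (by positivity))
    refine h1.trans (h2.trans ?_)
    rw [pow_one, ← mul_div_assoc, div_le_iff₀ (by linarith)]
    nlinarith
  have hS : ∀ M, M ≤ N₀ → ∑ k ∈ Icc 1 M, X k / k.factorial * t ^ k ≤ s := by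
    intro M
    induction M with
    | zero => intro _; simpa using hs0.le
    | succ M ih =>
      intro hM
      have ih := ih (by omega)
      -- Cutting off above `M` makes the polynomial of degree bound `M + 1` evaluate to the previous
      -- partial sum, to which the induction hypothesis applies.
      set X' : ℕ → ℝ := fun k => if k ≤ M then X k else 0 with hX'
      have hX'0 : ∀ k, 0 ≤ X' k := fun k => by
        simp only [hX']; split_ifs
        exacts [hX0 k, le_rfl]
      have hE : (expPoly (M + 1) X').eval t = ∑ k ∈ Icc 1 M, X k / k.factorial * t ^ k := by
        rw [eval_expPoly, Finset.sum_Icc_succ_top (by omega)]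
        simp only [hX']
        rw [if_neg (by omega), zero_div, zero_mul, add_zero]
        refine Finset.sum_congr rfl fun k hk => ?_
        rw [if_pos (Finset.mem_Icc.1 hk).2]
      have hE0 : 0 ≤ (expPoly (M + 1) X').eval t := by
        rw [hE]
        exact Finset.sum_nonneg fun k _ => mul_nonneg (div_nonneg (hX0 k) (by positivity))
          (by positivity)
      have hmono : (expPoly (M + 1) a).eval ((expPoly (M + 1) X').eval t) ≤ s / 2 := by
        refine le_trans ?_ (hA (M + 1) hM)
        rw [eval_expPoly (M + 1) a, eval_expPoly (M + 1) a]
        exact Finset.sum_le_sum fun k _ => mul_le_mul_of_nonneg_left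
          (pow_le_pow_left₀ hE0 (hE.trans_le ih) k) (div_nonneg (ha0 k) (by positivity))
      have hsum := (sum_sum_orderedFinpartition_le ha0 hX'0 (M + 1) ht0.le).trans hmono
      have hterm : ∑ k ∈ Icc 1 (M + 1), X k / k.factorial * t ^ k ≤
          ∑ k ∈ Icc 1 (M + 1), ((if k = 1 then B * t else 0) +
            (∑ c : OrderedFinpartition k, a c.length * ∏ j, X' (c.partSize j)) /
              k.factorial * t ^ k) := by
        refine Finset.sum_le_sum fun k hk => ?_
        rw [Finset.mem_Icc] at hk
        have hcs : 0 ≤ (∑ c : OrderedFinpartition k, a c.length * ∏ j, X' (c.partSize j)) /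
              k.factorial * t ^ k :=
          mul_nonneg (div_nonneg (Finset.sum_nonneg fun c _ => mul_nonneg (ha0 _)
            (Finset.prod_nonneg fun j _ => hX'0 _)) (by positivity)) (by positivity)
        split_ifs with h
        · subst h
          refine le_add_of_le_of_nonneg ?_ hcs
          simpa using mul_le_mul_of_nonneg_right hX1 ht0.le
        · rw [zero_add, ← sum_orderedFinpartition_congr_of_lt (b := X) ha1 hk.1
            fun l hl => by simp only [hX']; rw [if_pos (by omega)]]
          gcongr
          exact hX k (by omega) (by omega)
      rw [Finset.sum_add_distrib, Finset.sum_ite_eq' , if_pos (Finset.mem_Icc.2 ⟨le_rfl, by omega⟩),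
        hBt] at hterm
      linarith
  have h1 := (Finset.single_le_sum (f := fun k : ℕ => X k / k.factorial * t ^ k)
    (fun k _ => mul_nonneg (div_nonneg (hX0 k) (by positivity)) (by positivity))
    (Finset.mem_Icc.2 ⟨hN, le_refl N⟩)).trans (hS N hN₀)
  rw [div_mul_eq_mul_div, div_le_iff₀ (by positivity), ← le_div_iff₀ (by positivity)] at h1
  refine h1.trans_eq ?_
  obtain ⟨l, rfl⟩ : ∃ l, N = l + 1 := ⟨N - 1, by omega⟩
  have : 2 * (C + 1) * σ = 1 / s := by rw [hs, one_div_one_div]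
  rw [ht, this, Nat.add_sub_cancel]
  field_simp
  rw [← mul_pow, div_mul_cancel₀ _ (by positivity), pow_succ, one_div, inv_pow]
  field_simp

/-! ### FdB, odd FdB and almost increasing roots -/

/-- The Faà di Bruno property of a weight, restricted to odd indices. -/
def IsOddFdB (m : ℕ → ℝ) : Prop :=
  ∃ l : ℝ, 1 ≤ l ∧ ∀ r : ℕ, Odd r → ∀ k : Fin r → ℕ, (∀ i, Odd (k i)) →
    m r * ∏ i, m (k i) ≤ l ^ (∑ i, k i) * m (∑ i, k i)

/-- For each `N`, the weights `m 1, …, m N` are dominated by a geometric sequence that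
is attained, up to an exponential factor, at `N`. -/
def HasGeometricMajorants (m : ℕ → ℝ) : Prop :=
  ∃ A K : ℝ, 1 ≤ A ∧ 1 ≤ K ∧ ∀ N : ℕ, 1 ≤ N → ∃ L : ℝ, 0 < L ∧ L ^ (N - 1) ≤ A ^ N * m N ∧
    ∀ k, 1 ≤ k → k ≤ N → m k ≤ K * L ^ (k - 1)

theorem IsFdB.isOddFdB {m : ℕ → ℝ} (h : IsFdB m) : IsOddFdB m := by
  obtain ⟨l, hl, h⟩ := h
  exact ⟨l, hl, fun r hr k hk => h r hr.pos k fun i => (hk i).pos⟩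

/-- The exponents `r - 1` and `k i - 1` add up to `n - 1`, so the majorants multiply to exactly `L ^
(n - 1)`. The `r + 1` factors `K` are absorbed in `K ^ (2 * n)`. -/
theorem HasGeometricMajorants.isFdB {m : ℕ → ℝ} (hm : ∀ n, 1 ≤ n → 0 < m n)
    (h : HasGeometricMajorants m) : IsFdB m := by
  obtain ⟨A, K, hA, hK, h⟩ := h
  refine ⟨K ^ 2 * A, by nlinarith [one_le_pow₀ hK (n := 2)], fun r hr k hk => ?_⟩
  set n := ∑ i, k i with hn
  have hkn : ∀ i, k i ≤ n := fun i =>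
    Finset.single_le_sum (fun _ _ => Nat.zero_le _) (Finset.mem_univ i)
  have hrn : r ≤ n := by
    have := Finset.sum_le_sum fun i (_ : i ∈ (univ : Finset (Fin r))) => hk i
    simpa using this
  obtain ⟨L, hL, h1, h2⟩ := h n (hr.trans hrn)
  have hsum : ∑ i, (k i - 1) + r = n := by
    rw [hn]
    have : ∀ i, k i = (k i - 1) + 1 := fun i => by have := hk i; omega
    conv_rhs => rw [Finset.sum_congr rfl fun i _ => this i]
    simp [Finset.sum_add_distrib]
  have h3 : ∏ i, m (k i) ≤ K ^ r * L ^ (∑ i, (k i - 1)) := by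
    calc ∏ i, m (k i) ≤ ∏ i, K * L ^ (k i - 1) :=
          Finset.prod_le_prod (fun i _ => (hm _ (hk i)).le) fun i _ => h2 _ (hk i) (hkn i)
      _ = _ := by rw [Finset.prod_mul_distrib, Finset.prod_pow_eq_pow_sum]; simp
  have hmn := hm n (hr.trans hrn)
  calc m r * ∏ i, m (k i) ≤ (K * L ^ (r - 1)) * (K ^ r * L ^ (∑ i, (k i - 1))) :=
        mul_le_mul (h2 r hr hrn) h3 (Finset.prod_nonneg fun i _ => (hm _ (hk i)).le) (by positivity)
    _ = K ^ (r + 1) * L ^ (n - 1) := by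
        have : n - 1 = (r - 1) + ∑ i, (k i - 1) := by omega
        rw [this]; ring
    _ ≤ K ^ (2 * n) * (A ^ n * m n) := by
        gcongr
        omega
    _ = (K ^ 2 * A) ^ n * m n := by rw [mul_pow, ← pow_mul]; ring

theorem WeaklyLogConvex.pos {m : ℕ → ℝ} (hm : WeaklyLogConvex m) {n : ℕ} (hn : 1 ≤ n) :
    0 < m n := by
  obtain ⟨μ, h1, h2, h3⟩ := hm
  have hpos : ∀ k, 1 ≤ k → 0 < μ k := fun k hk => by
    induction k, hk using Nat.le_induction with
    | base => exact h1
    | succ k hk ih => exact ih.trans_le (h2 k hk)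
  have h := h3 n hn
  have : 0 < ∏ j ∈ Icc 1 n, μ j := Finset.prod_pos fun j hj => hpos j (Finset.mem_Icc.1 hj).1
  rw [← h] at this
  exact pos_of_mul_pos_right this (by positivity)

/-- The logarithm of the root `(m n)^{1/(n-1)}`. -/
noncomputable def logRoot (m : ℕ → ℝ) (n : ℕ) : ℝ := Real.log (m n) / ((n : ℝ) - 1)

theorem logRoot_mul (m : ℕ → ℝ) {n : ℕ} (hn : 2 ≤ n) :
    ((n : ℝ) - 1) * logRoot m n = Real.log (m n) := by
  have : (2 : ℝ) ≤ n := by exact_mod_cast hn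
  exact mul_div_cancel₀ _ (by linarith)

theorem Nat.log_factorial_le_sub_one_mul_log {n : ℕ} (hn : 1 ≤ n) :
    Real.log n.factorial ≤ ((n : ℝ) - 1) * Real.log n := by
  induction n, hn using Nat.le_induction with
  | base => simp
  | succ n hn ih =>
    have hn' : (1 : ℝ) ≤ n := by exact_mod_cast hn
    rw [Nat.factorial_succ]
    push_cast
    rw [Real.log_mul (by positivity) (by positivity)]
    have : Real.log n ≤ Real.log (n + 1) := Real.log_le_log (by linarith) (by linarith)
    nlinarith

theorem Nat.mul_log_sub_le_log_factorial {n : ℕ} (hn : 1 ≤ n) :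
    (n : ℝ) * Real.log n - n ≤ Real.log n.factorial := by
  have hn' : (1 : ℝ) ≤ n := by exact_mod_cast hn
  have h := Real.pow_div_factorial_le_exp (n : ℝ) (by linarith) n
  have h2 := Real.log_le_log (by positivity) h
  rw [Real.log_exp, Real.log_div (by positivity) (by positivity), Real.log_pow] at h2
  linarith

/-- The averages of `log (μ i)` over `2 ≤ i ≤ n` increase with `n`. Dividing out `n!` changes them
by `log n` up to a bounded error, and `log n - log j` is bounded as long as `n ≤ 4 * j`. -/
theorem WeaklyLogConvex.logRoot_le {m : ℕ → ℝ} (hm : WeaklyLogConvex m) :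
    ∃ C : ℝ, 0 ≤ C ∧ ∀ j n : ℕ, 2 ≤ j → j ≤ n → n ≤ 4 * j → logRoot m j ≤ logRoot m n + C := by
  have hmpos := fun n => hm.pos (n := n)
  obtain ⟨μ, h1, h2, h3⟩ := hm
  have hpos : ∀ k, 1 ≤ k → 0 < μ k := fun k hk => by
    induction k, hk using Nat.le_induction with
    | base => exact h1
    | succ k hk ih => exact ih.trans_le (h2 k hk)
  have hlogmono : ∀ k, 1 ≤ k → Real.log (μ k) ≤ Real.log (μ (k + 1)) := fun k hk =>
    Real.log_le_log (hpos k hk) (h2 k hk)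
  have hS : ∀ n, 1 ≤ n → Real.log n.factorial + Real.log (m n) =
      ∑ i ∈ Icc 1 n, Real.log (μ i) := fun n hn => by
    rw [← Real.log_mul (by positivity) (hmpos n hn).ne', h3 n hn]
    exact Real.log_prod fun i hi => (hpos i (Finset.mem_Icc.1 hi).1).ne'
  have hA : ∀ j, 1 ≤ j → (∑ i ∈ Icc 1 j, Real.log (μ i)) - Real.log (μ 1) ≤
      ((j : ℝ) - 1) * Real.log (μ j) := fun j hj => by
    induction j, hj using Nat.le_induction with
    | base => simp
    | succ j hj ih =>
      rw [Finset.sum_Icc_succ_top (by omega)]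
      have hj' : (1 : ℝ) ≤ j := by exact_mod_cast hj
      push_cast
      nlinarith [hlogmono j hj]
  have hmono : ∀ j n, 1 ≤ j → j ≤ n → Real.log (μ j) ≤ Real.log (μ n) := fun j n hj hn => by
    induction n, hn using Nat.le_induction with
    | base => exact le_rfl
    | succ n hn ih => exact ih.trans (hlogmono n (hj.trans hn))
  have hB : ∀ j n : ℕ, 1 ≤ j → j ≤ n →
      ((n : ℝ) - 1) * ((∑ i ∈ Icc 1 j, Real.log (μ i)) - Real.log (μ 1)) ≤
      ((j : ℝ) - 1) * ((∑ i ∈ Icc 1 n, Real.log (μ i)) - Real.log (μ 1)) := fun j n hj hn => by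
    induction n, hn using Nat.le_induction with
    | base => exact le_rfl
    | succ n hn ih =>
      have h4 : ((j : ℝ) - 1) * Real.log (μ j) ≤ ((j : ℝ) - 1) * Real.log (μ (n + 1)) :=
        mul_le_mul_of_nonneg_left (hmono j (n + 1) hj (by omega))
          (by have : (1 : ℝ) ≤ j := by exact_mod_cast hj
              linarith)
      rw [Finset.sum_Icc_succ_top (by omega : 1 ≤ n + 1)]
      have h5 := hA j hj
      push_cast
      linarith
  refine ⟨Real.log 4 + 2 + 2 * |Real.log (μ 1)|, by positivity, fun j n hj hjn hn4 => ?_⟩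
  have hj' : (2 : ℝ) ≤ j := by exact_mod_cast hj
  have hjn' : (j : ℝ) ≤ n := by exact_mod_cast hjn
  have hn4' : (n : ℝ) ≤ 4 * j := by exact_mod_cast hn4
  have h4 := hB j n (by omega) hjn
  rw [← hS j (by omega), ← hS n (by omega), ← logRoot_mul m hj, ← logRoot_mul m (hj.trans hjn)] at h4
  have h5 := Nat.log_factorial_le_sub_one_mul_log (n := n) (by omega)
  have h6 := Nat.mul_log_sub_le_log_factorial (n := j) (by omega)
  have hlog : Real.log n ≤ Real.log 4 + Real.log j := by
    rw [← Real.log_mul (by norm_num) (by positivity)]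
    exact Real.log_le_log (by linarith) hn4'
  have hlogj : 0 ≤ Real.log j := Real.log_nonneg (by linarith)
  set ν := Real.log (μ 1)
  set x := (j : ℝ) - 1 with hx
  set y := (n : ℝ) - 1 with hy
  have hx1 : 1 ≤ x := by linarith
  have hxy : x ≤ y := by linarith
  have h7 : x * (Real.log j - 2) ≤ Real.log j.factorial := by nlinarith
  have h8 : y * (x * (Real.log j - 2)) ≤ y * Real.log j.factorial :=
    mul_le_mul_of_nonneg_left h7 (by linarith)
  have h9 : x * Real.log n.factorial ≤ x * (y * (Real.log 4 + Real.log j)) :=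
    mul_le_mul_of_nonneg_left (h5.trans (mul_le_mul_of_nonneg_left hlog (by linarith)))
      (by linarith)
  have h10 : (y - x) * ν ≤ (x * y) * |ν| :=
    (mul_le_mul_of_nonneg_left (le_abs_self ν) (by linarith)).trans
      (mul_le_mul_of_nonneg_right (by nlinarith) (abs_nonneg ν))
  have h11 : (x * y) * logRoot m j ≤ (x * y) * (logRoot m n + (Real.log 4 + 2 + |ν|)) := by
    nlinarith
  have h12 := le_of_mul_le_mul_left h11 (by nlinarith)
  linarith [abs_nonneg ν]

theorem IsOddFdB.log_add_le {m : ℕ → ℝ} (hm : ∀ n, 1 ≤ n → 0 < m n) (h : IsOddFdB m) :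
    ∃ C : ℝ, 0 ≤ C ∧ ∀ t u j : ℕ, Odd (t + u) → Odd j →
      Real.log (m (t + u)) + t * Real.log (m j) ≤
        Real.log (m (t * j + u)) + C * ((t * j + u : ℕ) : ℝ) := by
  obtain ⟨l, hl, h⟩ := h
  refine ⟨Real.log l + |Real.log (m 1)|, add_nonneg (Real.log_nonneg hl) (abs_nonneg _),
    fun t u j hr hj => ?_⟩
  -- The parts are `t` copies of `j` and `u` copies of `1`; the powers of `m 1` go into the
  -- constant.
  have h1 := h (t + u) hr (Fin.append (fun _ => j) fun _ => 1) (fun i => by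
    induction i using Fin.addCases <;> simp [hj])
  have hpos := hm (t * j + u) (by
    have := hr.pos
    have := Nat.le_mul_of_pos_right t hj.pos
    omega)
  simp only [Fin.prod_univ_add, Fin.sum_univ_add, Fin.append_left, Fin.append_right,
    Finset.prod_const, Finset.sum_const, Finset.card_univ, Fintype.card_fin, smul_eq_mul,
    mul_one] at h1
  have hmr := hm _ hr.pos
  have hmj := hm _ hj.pos
  have hm1 := hm 1 le_rfl
  have h2 := Real.log_le_log (by positivity) h1
  rw [Real.log_mul (by positivity) (by positivity), Real.log_mul (by positivity) (by positivity),
    Real.log_mul (by positivity) (by positivity), Real.log_pow, Real.log_pow, Real.log_pow] at h2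
  have h3 : -((u : ℝ) * Real.log (m 1)) ≤ ((t * j + u : ℕ) : ℝ) * |Real.log (m 1)| := by
    have h4 : (u : ℝ) ≤ ((t * j + u : ℕ) : ℝ) := by exact_mod_cast Nat.le_add_left _ _
    have h5 := mul_le_mul_of_nonneg_left (neg_abs_le (Real.log (m 1))) (Nat.cast_nonneg (α := ℝ) u)
    have h6 := mul_le_mul_of_nonneg_right h4 (abs_nonneg (Real.log (m 1)))
    linarith
  linarith

theorem IsOddFdB.logRoot_le_of_odd {m : ℕ → ℝ} (hm : WeaklyLogConvex m) (h : IsOddFdB m) :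
    ∃ B : ℝ, 0 ≤ B ∧ ∀ j n : ℕ, 3 ≤ j → Odd j → Odd n → j ≤ n →
      logRoot m j ≤ logRoot m n + B := by
  obtain ⟨C₁, hC₁, hstep⟩ := hm.logRoot_le
  obtain ⟨C₂, hC₂, hfdb⟩ := h.log_add_le fun n => hm.pos
  refine ⟨C₁ + 8 * C₂, by positivity, fun j n hj3 hj => ?_⟩
  induction n using Nat.strong_induction_on with
  | _ n ih =>
  intro hn hjn
  by_cases hcase : n ≤ 4 * j
  · linarith [hstep j n (by omega) hjn hcase]
  obtain ⟨a, rfl⟩ := hj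
  obtain ⟨b, rfl⟩ := hn
  have ha : 1 ≤ a := by omega
  -- Here `j = 2 * a + 1` and `n = 2 * b + 1`. Enlarging `t` of `r` unit parts to `j` adds `2 * a *
  -- t`, so FdB links `r`, `j` and `n = r + 2 * a * t`. The increment is even, so `r` stays odd, and
  -- it lies between `b / 2` and `b`.
  set t := b / (2 * a) with ht
  have ht1 : 2 * a * t ≤ b := Nat.mul_div_le b (2 * a)
  have ht2 : b < 2 * a * (t + 1) := by
    have := Nat.lt_mul_div_succ b (by omega : 0 < 2 * a)
    simpa using this
  have hta : 2 * t ≤ 2 * a * t := Nat.mul_le_mul_right t (by omega)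
  have ht2' : b < 2 * a * t + 2 * a := by linarith
  have ht0 : 0 < t := by
    rcases Nat.eq_zero_or_pos t with h0 | h0
    · rw [h0] at ht2'; omega
    · exact h0
  have hta' : 2 * a ≤ 2 * a * t := Nat.le_mul_of_pos_right _ ht0
  set r := 2 * b + 1 - 2 * a * t with hr
  have hrodd : Odd r := ⟨b - a * t, by
    have : 2 * a * t = 2 * (a * t) := by ring
    omega⟩
  have hrj : 2 * a + 1 ≤ r := by omega
  have hrn : r < 2 * b + 1 := by omega
  have htr : t ≤ r := by omega
  have h1 := hfdb t (r - t) (2 * a + 1) (by rwa [Nat.add_sub_cancel' htr]) ⟨a, rfl⟩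
  have hsum : t * (2 * a + 1) + (r - t) = 2 * b + 1 := by
    have : t * (2 * a + 1) = 2 * a * t + t := by ring
    omega
  rw [hsum, Nat.add_sub_cancel' htr, ← logRoot_mul m (by omega : 2 ≤ r),
    ← logRoot_mul m (by omega : 2 ≤ 2 * a + 1), ← logRoot_mul m (by omega : 2 ≤ 2 * b + 1)] at h1
  have h2 := ih r hrn hrodd hrj
  have hrR : (r : ℝ) = 2 * b + 1 - 2 * a * t := by
    rw [hr, Nat.cast_sub (by omega)]; push_cast; ring
  have ht1R : 2 * (a : ℝ) * t ≤ b := by exact_mod_cast ht1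
  have ht2R : (b : ℝ) ≤ 2 * (2 * a * t) := by
    have : b ≤ 2 * (2 * a * t) := by omega
    exact_mod_cast this
  have hbR : (1 : ℝ) ≤ b := by
    have : 1 ≤ b := by omega
    exact_mod_cast this
  push_cast at h1
  set D := logRoot m (2 * a + 1)
  set E := logRoot m (2 * b + 1)
  set F := logRoot m r
  set w := 2 * (a : ℝ) * t with hw
  rw [hrR] at h1
  have h3 : (2 * (b : ℝ) - w) * (D - (C₁ + 8 * C₂)) ≤ (2 * (b : ℝ) - w) * F :=
    mul_le_mul_of_nonneg_left (by linarith) (by linarith)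
  have h4 : (2 * (b : ℝ)) * D ≤ (2 * (b : ℝ)) * E + C₂ * (2 * b + 1) +
      (2 * (b : ℝ) - w) * (C₁ + 8 * C₂) := by
    have : (t : ℝ) * ((2 * a + 1 - 1) * D) = w * D := by rw [hw]; ring
    rw [this] at h1
    linarith
  -- Since `r - 1 = 2 * b - w ≤ 3 / 2 * b`, the induction error returns with factor `3 / 4` only.
  -- The constant `C₁ + 8 * C₂` leaves room for the new error `3 / 2 * C₂`.
  have h5 : (2 * (b : ℝ) - w) * (C₁ + 8 * C₂) ≤ (3 / 2 * b) * (C₁ + 8 * C₂) :=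
    mul_le_mul_of_nonneg_right (by linarith) (by positivity)
  have h6 : C₂ * (2 * b + 1) ≤ C₂ * (3 * b) := mul_le_mul_of_nonneg_left (by linarith) hC₂
  have h7 : (2 * (b : ℝ)) * D ≤ (2 * (b : ℝ)) * (E + (C₁ + 8 * C₂)) := by
    nlinarith [mul_nonneg hC₁ (by linarith : (0 : ℝ) ≤ b), mul_nonneg hC₂ (by linarith : (0 : ℝ) ≤ b)]
  exact le_of_mul_le_mul_left h7 (by linarith)

/-- Each index moves to a neighbouring odd one at the cost of one short-range comparison; `n > 4 *
j` keeps the odd indices in order. -/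
theorem IsOddFdB.logRoot_le {m : ℕ → ℝ} (hm : WeaklyLogConvex m) (h : IsOddFdB m) :
    ∃ B : ℝ, 0 ≤ B ∧ ∀ j n : ℕ, 2 ≤ j → j ≤ n → logRoot m j ≤ logRoot m n + B := by
  obtain ⟨C, hC, hstep⟩ := hm.logRoot_le
  obtain ⟨B, hB, hodd⟩ := h.logRoot_le_of_odd hm
  refine ⟨B + 2 * C, by positivity, fun j n hj hjn => ?_⟩
  by_cases hn : n ≤ 4 * j
  · linarith [hstep j n hj hjn hn]
  obtain ⟨j', hj', h1, h2⟩ : ∃ j', Odd j' ∧ j ≤ j' ∧ j' ≤ j + 1 := by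
    rcases Nat.even_or_odd j with h | h
    · exact ⟨j + 1, h.add_one, by omega, le_rfl⟩
    · exact ⟨j, h, le_rfl, by omega⟩
  obtain ⟨n', hn', h3, h4⟩ : ∃ n', Odd n' ∧ n' ≤ n ∧ n ≤ n' + 1 := by
    rcases Nat.even_or_odd n with h | h
    · exact ⟨n - 1, by
        obtain ⟨c, rfl⟩ := h
        exact ⟨c - 1, by omega⟩, by omega, by omega⟩
    · exact ⟨n, h, le_rfl, by omega⟩
  have h5 := hstep j j' hj h1 (by omega)
  have h6 := hodd j' n' (by obtain ⟨c, rfl⟩ := hj'; omega) hj' hn' (by omega)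
  have h7 := hstep n' n (by omega) h3 (by omega)
  linarith

theorem IsOddFdB.hasGeometricMajorants {m : ℕ → ℝ} (hm : WeaklyLogConvex m) (h : IsOddFdB m) :
    HasGeometricMajorants m := by
  obtain ⟨B, hB, hle⟩ := h.logRoot_le hm
  have hm1 := hm.pos le_rfl
  refine ⟨max (Real.exp B) (m 1)⁻¹, max 1 (m 1), le_max_of_le_left (Real.one_le_exp hB),
    le_max_left _ _, fun N hN => ?_⟩
  rcases hN.eq_or_lt with rfl | hN
  · refine ⟨1, one_pos, ?_, fun k h1 h2 => ?_⟩
    · rw [pow_one, one_pow]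
      calc (1 : ℝ) = (m 1)⁻¹ * m 1 := (inv_mul_cancel₀ hm1.ne').symm
        _ ≤ _ := mul_le_mul_of_nonneg_right (le_max_right _ _) hm1.le
    · obtain rfl : k = 1 := by omega
      simp
  have hexp : ∀ (x : ℝ) (k : ℕ), 1 ≤ k → Real.exp x ^ (k - 1) = Real.exp (((k : ℝ) - 1) * x) :=
    fun x k hk => by
      rw [← Real.exp_nat_mul, Nat.cast_sub hk, Nat.cast_one]
  -- The ratio is the root of `m N`, enlarged by the loss `B` in monotonicity so that it dominates
  -- the roots of all earlier weights.
  refine ⟨Real.exp (logRoot m N + B), Real.exp_pos _, ?_, fun k h1 h2 => ?_⟩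
  · rw [Real.exp_add, mul_pow, hexp _ N hN.le, logRoot_mul m hN, Real.exp_log (hm.pos hN.le), mul_comm]
    refine mul_le_mul_of_nonneg_right ?_ (hm.pos hN.le).le
    calc Real.exp B ^ (N - 1) ≤ Real.exp B ^ N :=
          pow_le_pow_right₀ (Real.one_le_exp hB) (Nat.sub_le _ _)
      _ ≤ _ := pow_le_pow_left₀ (Real.exp_pos _).le (le_max_left _ _) _
  · rcases h1.eq_or_lt with rfl | h1
    · simp
    have h3 : m k ≤ Real.exp (logRoot m N + B) ^ (k - 1) := by
      rw [hexp _ k h1.le, ← Real.log_le_iff_le_exp (hm.pos h1.le), ← logRoot_mul m h1]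
      have : (2 : ℝ) ≤ k := by exact_mod_cast h1
      exact mul_le_mul_of_nonneg_left (hle k N h1 h2) (by linarith)
    exact h3.trans (le_mul_of_one_le_left (by positivity) (le_max_left _ _))

/-! ### Sufficiency of FdB for composition and inversion -/

theorem norm_iteratedFDeriv_comp_le_sum {E F G : Type*} [NormedAddCommGroup E] [NormedSpace ℝ E]
    [NormedAddCommGroup F] [NormedSpace ℝ F] [NormedAddCommGroup G] [NormedSpace ℝ G]
    {g : F → G} {f : E → F} {x : E} (hg : ContDiffAt ℝ ∞ g (f x)) (hf : ContDiffAt ℝ ∞ f x)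
    (n : ℕ) :
    ‖iteratedFDeriv ℝ n (g ∘ f) x‖ ≤ ∑ c : OrderedFinpartition n,
      ‖iteratedFDeriv ℝ c.length g (f x)‖ * ∏ j, ‖iteratedFDeriv ℝ (c.partSize j) f x‖ := by
  rw [iteratedFDeriv_comp hg hf (by exact_mod_cast le_top)]
  exact (norm_sum_le _ _).trans (Finset.sum_le_sum fun c _ =>
    c.norm_compAlongOrderedFinpartition_le _ _)

theorem iteratedFDeriv_clm_of_two_le {E F : Type*} [NormedAddCommGroup E] [NormedSpace ℝ E]
    [NormedAddCommGroup F] [NormedSpace ℝ F] (T : E →L[ℝ] F) {n : ℕ} (hn : 2 ≤ n) (x : E) :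
    iteratedFDeriv ℝ n T x = 0 := by
  obtain ⟨n, rfl⟩ : ∃ l, n = l + 1 := ⟨n - 1, by omega⟩
  rw [← norm_eq_zero, ← norm_iteratedFDeriv_fderiv]
  have : fderiv ℝ T = fun _ => T := funext fun x => T.fderiv
  rw [this, iteratedFDeriv_const_of_ne (by omega)]
  simp

theorem isClassE_iff {m : ℕ → ℝ} (hm : ∀ n, 1 ≤ n → 0 < m n) {s q : ℕ}
    {f : EuclideanSpace ℝ (Fin s) → EuclideanSpace ℝ (Fin q)} {Ω : Set (EuclideanSpace ℝ (Fin s))} :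
    IsClassE m f Ω ↔ ContDiffOn ℝ ∞ f Ω ∧ ∀ a ∈ Ω, ∃ U ∈ 𝓝 a, U ⊆ Ω ∧ ∃ C ρ : ℝ, 1 ≤ C ∧ 1 ≤ ρ ∧
      ∀ x ∈ U, ∀ n : ℕ, 1 ≤ n → ‖iteratedFDeriv ℝ n f x‖ ≤ C * ρ ^ n * (n.factorial * m n) := by
  refine and_congr_right fun _ => forall₂_congr fun a _ => exists_congr fun U => and_congr_right
    fun _ => and_congr_right fun _ => ⟨?_, ?_⟩
  · rintro ⟨r, hr, C, h⟩
    refine ⟨max C 1, max (1 / r) 1, le_max_right _ _, le_max_right _ _, fun x hx n hn => ?_⟩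
    have h1 := h x hx n hn
    have hmn := hm n hn
    have h2 : ‖iteratedFDeriv ℝ n f x‖ ≤ C * (1 / r) ^ n * (n.factorial * m n) := by
      have : ‖iteratedFDeriv ℝ n f x‖ =
          (1 / (n.factorial : ℝ) * (‖iteratedFDeriv ℝ n f x‖ / m n) * r ^ n) * (1 / r) ^ n *
            (n.factorial * m n) := by
        rw [one_div_pow]; field_simp
      rw [this]
      gcongr
    refine h2.trans ?_
    gcongr
    · exact le_max_left _ _
    · exact le_max_left _ _
  · rintro ⟨C, ρ, hC, hρ, h⟩
    refine ⟨1 / ρ, by positivity, C, fun x hx n hn => ?_⟩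
    have hmn := hm n hn
    have h1 := h x hx n hn
    calc 1 / (n.factorial : ℝ) * (‖iteratedFDeriv ℝ n f x‖ / m n) * (1 / ρ) ^ n
        ≤ 1 / (n.factorial : ℝ) * (C * ρ ^ n * (n.factorial * m n) / m n) * (1 / ρ) ^ n := by gcongr
      _ = C := by rw [one_div_pow]; field_simp

theorem IsFdB.compositionClosed {m : ℕ → ℝ} (hm : ∀ n, 1 ≤ n → 0 < m n) (h : IsFdB m)
    (s p q : ℕ) : CompositionClosed m s p q := by
  obtain ⟨l, hl, hfdb⟩ := h
  intro Ω Ω' h g hΩ hΩ' hmap hh hg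
  rw [isClassE_iff hm] at hh hg ⊢
  obtain ⟨hhs, hhb⟩ := hh
  obtain ⟨hgs, hgb⟩ := hg
  refine ⟨hgs.comp hhs hmap, fun a ha => ?_⟩
  obtain ⟨U, hU, hUΩ, C₁, ρ₁, hC₁, hρ₁, hb₁⟩ := hhb a ha
  obtain ⟨V, hV, hVΩ, C₂, ρ₂, hC₂, hρ₂, hb₂⟩ := hgb (h a) (hmap ha)
  have hcont : ContinuousAt h a := (hhs.contDiffAt (hΩ.mem_nhds ha)).continuousAt
  refine ⟨U ∩ h ⁻¹' V, Filter.inter_mem hU (hcont hV), Set.inter_subset_left.trans hUΩ,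
    C₂, C₁ * ρ₁ * ρ₂ * l * 4, hC₂, ?_, fun x hx n hn => ?_⟩
  · have h1 : 1 ≤ C₁ * ρ₁ := one_le_mul_of_one_le_of_one_le hC₁ hρ₁
    have h2 : 1 ≤ C₁ * ρ₁ * ρ₂ := one_le_mul_of_one_le_of_one_le h1 hρ₂
    have h3 : 1 ≤ C₁ * ρ₁ * ρ₂ * l := one_le_mul_of_one_le_of_one_le h2 hl
    linarith
  have hmn := hm n hn
  refine (norm_iteratedFDeriv_comp_le_sum (hgs.contDiffAt (hΩ'.mem_nhds (hVΩ hx.2)))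
    (hhs.contDiffAt (hΩ.mem_nhds (hUΩ hx.1))) n).trans ?_
  have hterm : ∀ c : OrderedFinpartition n,
      ‖iteratedFDeriv ℝ c.length g (h x)‖ * ∏ j, ‖iteratedFDeriv ℝ (c.partSize j) h x‖ ≤
      C₂ * (C₁ * ρ₁ * ρ₂ * l) ^ n * m n *
        (c.length.factorial * ∏ j, ((c.partSize j).factorial : ℝ)) := by
    intro c
    have hlen : 1 ≤ c.length := c.length_pos hn
    have hml := hm _ hlen
    have hmp : ∀ j, 0 < m (c.partSize j) := fun j => hm _ (c.partSize_pos j)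
    have h1 := hb₂ (h x) hx.2 c.length hlen
    have h2 : ∏ j, ‖iteratedFDeriv ℝ (c.partSize j) h x‖ ≤
        C₁ ^ c.length * ρ₁ ^ n * ((∏ j, ((c.partSize j).factorial : ℝ)) * ∏ j, m (c.partSize j)) := by
      refine (Finset.prod_le_prod (fun j _ => norm_nonneg _) fun j _ =>
        hb₁ x hx.1 _ (c.partSize_pos j)).trans_eq ?_
      rw [Finset.prod_mul_distrib, Finset.prod_mul_distrib, Finset.prod_mul_distrib,
        Finset.prod_pow_eq_pow_sum, c.sum_partSize]
      simp
    have h3 := hfdb c.length hlen c.partSize c.partSize_pos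
    rw [c.sum_partSize] at h3
    have hP : 0 < ∏ j, m (c.partSize j) := Finset.prod_pos fun j _ => hmp j
    calc _ ≤ (C₂ * ρ₂ ^ c.length * (c.length.factorial * m c.length)) *
          (C₁ ^ c.length * ρ₁ ^ n *
            ((∏ j, ((c.partSize j).factorial : ℝ)) * ∏ j, m (c.partSize j))) := by gcongr
      _ = C₂ * (ρ₂ ^ c.length * C₁ ^ c.length * ρ₁ ^ n) *
          (m c.length * ∏ j, m (c.partSize j)) *
          (c.length.factorial * ∏ j, ((c.partSize j).factorial : ℝ)) := by ring
      _ ≤ C₂ * (ρ₂ ^ n * C₁ ^ n * ρ₁ ^ n) * (l ^ n * m n) *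
          (c.length.factorial * ∏ j, ((c.partSize j).factorial : ℝ)) := by
        gcongr
        · exact c.length_le
        · exact c.length_le
      _ = _ := by rw [mul_pow, mul_pow, mul_pow]; ring
  refine (Finset.sum_le_sum fun c _ => hterm c).trans ?_
  rw [← Finset.mul_sum]
  refine (mul_le_mul_of_nonneg_left (sum_orderedFinpartition_factorial_le n)
    (by positivity)).trans_eq ?_
  rw [mul_pow _ (4 : ℝ)]
  ring

/-- Bounds for the derivatives of a local inverse `f` of `g` at `y`, given geometric bounds for
the derivatives of `g` at `f y` up to order `N₀`. -/
theorem norm_iteratedFDeriv_localInverse_le {E : Type*} [NormedAddCommGroup E] [NormedSpace ℝ E]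
    {f g : E → E} {y : E} (hf : ContDiffAt ℝ ∞ f y) (hg : ContDiffAt ℝ ∞ g (f y))
    (hgf : ∀ᶠ z in 𝓝 y, g (f z) = z) (hfg : ∀ᶠ x in 𝓝 (f y), f (g x) = x)
    {B C σ : ℝ} {N₀ : ℕ} (hB : 0 < B) (hC : 0 ≤ C) (hσ : 0 < σ) (hfB : ‖fderiv ℝ f y‖ ≤ B)
    (hgb : ∀ r, 2 ≤ r → r ≤ N₀ →
      ‖iteratedFDeriv ℝ r g (f y)‖ ≤ C * r.factorial * σ ^ (r - 1))
    {N : ℕ} (hN : 1 ≤ N) (hN₀ : N ≤ N₀) :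
    ‖iteratedFDeriv ℝ N f y‖ ≤
      N.factorial * ((2 * B) ^ N * (2 * (B * C + 1) * σ) ^ (N - 1)) := by
  set T : E →L[ℝ] E := fderiv ℝ f y with hT
  set k : E → E := T ∘ g - ContinuousLinearMap.id ℝ E with hk
  have hTg : ContDiffAt ℝ ∞ (T ∘ g) (f y) := T.contDiff.contDiffAt.comp _ hg
  have hid : ContDiffAt ℝ ∞ (ContinuousLinearMap.id ℝ E) (f y) :=
    (ContinuousLinearMap.id ℝ E).contDiff.contDiffAt
  have hks : ContDiffAt ℝ ∞ k (f y) := hTg.sub hid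
  have hgy : g (f y) = y := hgf.self_of_nhds
  have hk1 : fderiv ℝ k (f y) = 0 := by
    have h1 : HasFDerivAt (f ∘ g) (T.comp (fderiv ℝ g (f y))) (f y) := by
      refine HasFDerivAt.comp _ ?_ (hg.differentiableAt (by simp)).hasFDerivAt
      rw [hgy]
      exact (hf.differentiableAt (by simp)).hasFDerivAt
    have h2 : HasFDerivAt (f ∘ g) (ContinuousLinearMap.id ℝ E) (f y) :=
      (hasFDerivAt_id (f y)).congr_of_eventuallyEq hfg
    have h3 : HasFDerivAt k (T.comp (fderiv ℝ g (f y)) - ContinuousLinearMap.id ℝ E) (f y) :=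
      (T.hasFDerivAt.comp _ (hg.differentiableAt (by simp)).hasFDerivAt).sub
        (ContinuousLinearMap.id ℝ E).hasFDerivAt
    rw [h3.fderiv, h1.unique h2, sub_self]
  have hfk : f =ᶠ[𝓝 y] (T : E → E) - k ∘ f := by
    filter_upwards [hgf] with z hz
    simp [hk, hz]
  refine le_of_le_sum_orderedFinpartition (a := fun r => ‖iteratedFDeriv ℝ r k (f y)‖)
    (X := fun n => ‖iteratedFDeriv ℝ n f y‖) hB (mul_nonneg hB.le hC) hσ (fun _ => norm_nonneg _)
    (fun _ => norm_nonneg _) ?_ ?_ ?_ ?_ hN hN₀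
  · simp only [norm_iteratedFDeriv_one, hk1, norm_zero]
  · intro r h2 hr
    rw [hk, iteratedFDeriv_sub_apply (hTg.of_le (by exact_mod_cast le_top))
      (hid.of_le (by exact_mod_cast le_top)), iteratedFDeriv_clm_of_two_le _ h2, sub_zero]
    refine (T.norm_iteratedFDeriv_comp_left hg (by exact_mod_cast le_top)).trans ?_
    rw [mul_assoc B, mul_assoc B]
    exact mul_le_mul hfB (hgb r h2 hr) (norm_nonneg _) hB.le
  · simpa only [norm_iteratedFDeriv_one] using hfB
  · intro n hn _
    rw [(hfk.iteratedFDeriv ℝ n).self_of_nhds, iteratedFDeriv_sub_apply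
      (T.contDiff.contDiffAt) ((hks.comp y hf).of_le (by exact_mod_cast le_top)),
      iteratedFDeriv_clm_of_two_le _ hn, zero_sub, norm_neg]
    exact norm_iteratedFDeriv_comp_le_sum hks hf n

theorem HasGeometricMajorants.inversionClosed {m : ℕ → ℝ} (hm : ∀ n, 1 ≤ n → 0 < m n)
    (h : HasGeometricMajorants m) (d : ℕ) : InversionClosed m d := by
  obtain ⟨A, K, hA, hK, hmaj⟩ := h
  intro Ω g e hΩ hg he heq hes
  rw [isClassE_iff hm] at hg ⊢
  obtain ⟨hgs, hgb⟩ := hg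
  refine ⟨hes, fun b hb => ?_⟩
  have hsmooth : ∀ y ∈ e.target, ContDiffAt ℝ ∞ e.symm y := fun y hy =>
    hes.contDiffAt (e.open_target.mem_nhds hy)
  obtain ⟨U, hU, hUΩ, C, ρ, hC, hρ, hb₁⟩ := hgb (e.symm b) (he (e.map_target hb))
  set B := ‖fderiv ℝ e.symm b‖ + 1 with hBdef
  have hB : 1 ≤ B := le_add_of_nonneg_left (norm_nonneg _)
  have hcont : ContinuousAt (fun y => ‖fderiv ℝ e.symm y‖) b :=
    ((hsmooth b hb).fderiv_right (m := 0) (by simp)).continuousAt.norm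
  have hev : ∀ᶠ y in 𝓝 b, ‖fderiv ℝ e.symm y‖ < B :=
    hcont.eventually_lt continuousAt_const (by rw [hBdef]; exact lt_add_one _)
  refine ⟨e.target ∩ (e.symm ⁻¹' U ∩ {y | ‖fderiv ℝ e.symm y‖ < B}),
    Filter.inter_mem (e.open_target.mem_nhds hb) (Filter.inter_mem
      ((hsmooth b hb).continuousAt hU) hev), Set.inter_subset_left,
    1, 2 * B * (2 * (B * (C * K * ρ) + 1) * ρ) * A, le_rfl, ?_, fun y hy n hn => ?_⟩
  · have h1 : 0 ≤ B * (C * K * ρ) := by positivity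
    have h2 : 1 ≤ 2 * (B * (C * K * ρ) + 1) * ρ :=
      one_le_mul_of_one_le_of_one_le (by linarith) hρ
    exact one_le_mul_of_one_le_of_one_le (one_le_mul_of_one_le_of_one_le (by linarith) h2) hA
  obtain ⟨hyt, hyU, hyB⟩ := hy
  have hmn := hm n hn
  -- The ratio `L` depends on the order `n`, but it enters the final bound only through `L ^ (n - 1)
  -- ≤ A ^ n * m n`; all other constants are independent of `n`.
  obtain ⟨L, hL, hL1, hL2⟩ := hmaj n hn
  have hsrc : e.symm y ∈ e.source := e.map_target hyt
  have key := norm_iteratedFDeriv_localInverse_le (f := e.symm) (g := g) (y := y) (B := B)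
    (C := C * K * ρ) (σ := ρ * L) (N₀ := n) (hsmooth y hyt)
    (hgs.contDiffAt (hΩ.mem_nhds (he hsrc)))
    (by
      filter_upwards [e.open_target.mem_nhds hyt] with z hz
      rw [← heq (e.map_target hz), e.right_inv hz])
    (by
      filter_upwards [e.open_source.mem_nhds hsrc] with z hz
      rw [← heq hz, e.left_inv hz])
    (by positivity) (by positivity) (by positivity) (le_of_lt hyB)
    (fun r h2 hr => by
      have hmr := hm r (by omega)
      refine (hb₁ _ hyU r (by omega)).trans ?_
      calc C * ρ ^ r * (r.factorial * m r) ≤ C * ρ ^ r * (r.factorial * (K * L ^ (r - 1))) := by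
            gcongr
            exact hL2 r (by omega) hr
        _ = _ := by
          obtain ⟨l, rfl⟩ : ∃ l, r = l + 1 := ⟨r - 1, by omega⟩
          rw [Nat.add_sub_cancel]
          ring)
    hn le_rfl
  refine key.trans ?_
  set D := 2 * (B * (C * K * ρ) + 1) * ρ with hD
  have hD1 : 1 ≤ D := by
    have h1 : 0 ≤ B * (C * K * ρ) := by positivity
    exact one_le_mul_of_one_le_of_one_le (by linarith) hρ
  calc (n.factorial : ℝ) * ((2 * B) ^ n * (2 * (B * (C * K * ρ) + 1) * (ρ * L)) ^ (n - 1))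
      = n.factorial * ((2 * B) ^ n * (D ^ (n - 1) * L ^ (n - 1))) := by
        rw [← mul_pow D, hD]; ring
    _ ≤ n.factorial * ((2 * B) ^ n * (D ^ n * (A ^ n * m n))) := by
        gcongr
        omega
    _ = 1 * (2 * B * D * A) ^ n * (n.factorial * m n) := by rw [mul_pow _ A, mul_pow _ D]; ring

/-! ### A characteristic function with alternating odd derivatives -/

theorem Real.iteratedDeriv_sin_zero_of_even {n : ℕ} (hn : Even n) :
    iteratedDeriv n Real.sin 0 = 0 := by
  obtain ⟨i, rfl⟩ := hn
  rw [← two_mul, Real.iteratedDeriv_even_sin]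
  simp

theorem Real.iteratedDeriv_sin_zero_of_odd {n : ℕ} (hn : Odd n) :
    iteratedDeriv n Real.sin 0 = (-1) ^ (n / 2) := by
  obtain ⟨i, rfl⟩ := hn
  rw [Real.iteratedDeriv_odd_sin]
  have : (2 * i + 1) / 2 = i := by omega
  simp [this]

/-- Log-convexity in the form of a supporting line at `k`: the factors between `k` and `n` are at
least `μ k` when `n ≥ k`, and at most `μ k` when `n ≤ k`. -/
theorem prod_Icc_mul_pow_le {μ : ℕ → ℝ} (hpos : ∀ k, 1 ≤ k → 0 < μ k)
    (hmono : ∀ j k, 1 ≤ j → j ≤ k → μ j ≤ μ k) {k : ℕ} (hk : 1 ≤ k) (n : ℕ) :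
    (∏ j ∈ Icc 1 k, μ j) * μ k ^ n ≤ (∏ j ∈ Icc 1 n, μ j) * μ k ^ k := by
  have hP : ∀ n, 0 < ∏ j ∈ Icc 1 n, μ j := fun n =>
    Finset.prod_pos fun j hj => hpos j (Finset.mem_Icc.1 hj).1
  have hk0 := hpos k hk
  rcases le_total k n with h | h
  · induction n, h using Nat.le_induction with
    | base => exact le_rfl
    | succ n h ih =>
      rw [Finset.prod_Icc_succ_top (by omega), pow_succ]
      calc (∏ j ∈ Icc 1 k, μ j) * (μ k ^ n * μ k) = ((∏ j ∈ Icc 1 k, μ j) * μ k ^ n) * μ k := by ring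
        _ ≤ ((∏ j ∈ Icc 1 n, μ j) * μ k ^ k) * μ (n + 1) :=
          mul_le_mul ih (hmono k (n + 1) hk (by omega)) hk0.le
            (mul_nonneg (hP n).le (by positivity))
        _ = _ := by ring
  · have key : ∀ j, n ≤ j → j ≤ k → (∏ i ∈ Icc 1 j, μ i) * μ k ^ n ≤
        (∏ i ∈ Icc 1 n, μ i) * μ k ^ j := fun j hj => by
      induction j, hj using Nat.le_induction with
      | base => intro _; exact le_rfl
      | succ j hj ih =>
        intro hjk
        rw [Finset.prod_Icc_succ_top (by omega), pow_succ]
        calc (∏ i ∈ Icc 1 j, μ i) * μ (j + 1) * μ k ^ n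
            = ((∏ i ∈ Icc 1 j, μ i) * μ k ^ n) * μ (j + 1) := by ring
          _ ≤ ((∏ i ∈ Icc 1 n, μ i) * μ k ^ j) * μ k :=
            mul_le_mul (ih (by omega)) (hmono (j + 1) k (by omega) hjk) (hpos _ (by omega)).le
              (mul_nonneg (hP n).le (by positivity))
          _ = _ := by ring
    exact key k h le_rfl

/-- A weakly log-convex weight admits a smooth function on the line whose derivatives are bounded
by `n! m n` everywhere and are as large as `n! m n / 2 ^ n`, with the signs of the sine function,
at the origin. -/
theorem WeaklyLogConvex.exists_characteristic {m : ℕ → ℝ} (hm : WeaklyLogConvex m) :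
    ∃ (H : ℝ → ℝ) (η : ℕ → ℝ), ContDiff ℝ ∞ H ∧ (∀ n, 0 ≤ η n) ∧ (∀ n, Even n → η n = 0) ∧
      (∀ n, Odd n → n.factorial * m n / 2 ^ n ≤ η n) ∧
      (∀ n, 1 ≤ n → ∀ x, |iteratedDeriv n H x| ≤ n.factorial * m n) ∧
      ∀ n, iteratedDeriv n H 0 = (-1) ^ (n / 2) * η n := by
  obtain ⟨μ, h1, h2, h3⟩ := hm
  have hpos : ∀ k, 1 ≤ k → 0 < μ k := fun k hk => by
    induction k, hk using Nat.le_induction with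
    | base => exact h1
    | succ k hk ih => exact ih.trans_le (h2 k hk)
  have hmono : ∀ j k, 1 ≤ j → j ≤ k → μ j ≤ μ k := fun j k hj hk => by
    induction k, hk using Nat.le_induction with
    | base => exact le_rfl
    | succ k hk ih => exact ih.trans (h2 k (hj.trans hk))
  set M : ℕ → ℝ := fun n => ∏ j ∈ Icc 1 n, μ j with hM
  have hM0 : ∀ n, 0 < M n := fun n =>
    Finset.prod_pos fun j hj => hpos j (Finset.mem_Icc.1 hj).1
  -- The amplitude makes the `n`-th derivative of the `k`-th sine at most `M n / 2 ^ (k + 1)`, with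
  -- no loss in `w k * μ (k + 1) ^ n` at `n = k + 1`. The upper bounds sum to `M n`, and that one
  -- term supplies the lower bound at `0`.
  set w : ℕ → ℝ := fun k => M (k + 1) / μ (k + 1) ^ (k + 1) / 2 / 2 ^ k with hw
  have hμ : ∀ k, 0 < μ (k + 1) := fun k => hpos _ (by omega)
  have hw0 : ∀ k, 0 < w k := fun k => by
    have := hM0 (k + 1); have := hμ k
    simp only [hw]; positivity
  have hwle : ∀ n k, w k * μ (k + 1) ^ n ≤ M n / 2 / 2 ^ k := fun n k => by
    have hμk := hμ k
    have h : M (k + 1) * μ (k + 1) ^ n ≤ M n * μ (k + 1) ^ (k + 1) :=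
      prod_Icc_mul_pow_le hpos hmono (k := k + 1) (by omega) n
    have : M (k + 1) / μ (k + 1) ^ (k + 1) * μ (k + 1) ^ n ≤ M n := by
      rw [div_mul_eq_mul_div, div_le_iff₀ (by positivity)]; exact h
    calc w k * μ (k + 1) ^ n =
        (M (k + 1) / μ (k + 1) ^ (k + 1) * μ (k + 1) ^ n) / 2 / 2 ^ k := by simp only [hw]; ring
      _ ≤ _ := by gcongr
  have hsummable : ∀ n, Summable fun k => w k * μ (k + 1) ^ n := fun n =>
    Summable.of_nonneg_of_le (fun k => mul_nonneg (hw0 k).le (pow_nonneg (hμ k).le _))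
      (hwle n) (hasSum_geometric_two' (M n)).summable
  set f : ℕ → ℝ → ℝ := fun k x => w k * Real.sin (μ (k + 1) * x) with hf
  have hfs : ∀ k, ContDiff ℝ ∞ (f k) := fun k =>
    contDiff_const.mul (Real.contDiff_sin.comp (contDiff_const.mul contDiff_id))
  have hfd : ∀ n k x, iteratedDeriv n (f k) x =
      w k * μ (k + 1) ^ n * iteratedDeriv n Real.sin (μ (k + 1) * x) := fun n k x => by
    simp only [hf]
    rw [iteratedDeriv_const_mul_field, iteratedDeriv_comp_const_mul Real.contDiff_sin, mul_assoc]
  have hfb : ∀ (n k : ℕ) (x : ℝ), ‖iteratedFDeriv ℝ n (f k) x‖ ≤ M n / 2 / 2 ^ k := fun n k x => by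
    rw [norm_iteratedFDeriv_eq_norm_iteratedDeriv, hfd, Real.norm_eq_abs, abs_mul,
      abs_of_nonneg (mul_nonneg (hw0 k).le (pow_nonneg (hμ k).le _))]
    refine le_trans ?_ (hwle n k)
    exact mul_le_of_le_one_right (mul_nonneg (hw0 k).le (pow_nonneg (hμ k).le _))
      (Real.abs_iteratedDeriv_sin_le_one n _)
  have hsM : ∀ n, Summable fun k : ℕ => M n / 2 / 2 ^ k := fun n =>
    (hasSum_geometric_two' (M n)).summable
  have hsF : ∀ n x, Summable fun k => iteratedFDeriv ℝ n (f k) x := fun n x =>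
    .of_norm_bounded (hsM n) fun k => hfb n k x
  have hH : ∀ n x, iteratedFDeriv ℝ n (fun y => ∑' k, f k y) x =
      ∑' k, iteratedFDeriv ℝ n (f k) x := fun n x =>
    iteratedFDeriv_tsum_apply (N := ⊤) (v := fun n k => M n / 2 / 2 ^ k) hfs (fun n _ => hsM n)
      (fun n k x _ => hfb n k x) le_top x
  refine ⟨fun y => ∑' k, f k y, fun n => if Even n then 0 else ∑' k, w k * μ (k + 1) ^ n,
    contDiff_tsum (N := ⊤) (v := fun n k => M n / 2 / 2 ^ k) hfs (fun n _ => hsM n)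
      (fun n k x _ => hfb n k x), fun n => ?_, fun n hn => if_pos hn, fun n hn => ?_,
      fun n hn x => ?_, fun n => ?_⟩
  · simp only
    split_ifs
    · exact le_rfl
    · exact tsum_nonneg fun k => mul_nonneg (hw0 k).le (pow_nonneg (hμ k).le _)
  · simp only
    rw [if_neg (Nat.not_even_iff_odd.2 hn)]
    obtain ⟨l, rfl⟩ : ∃ l, n = l + 1 := ⟨n - 1, by have := hn.pos; omega⟩
    refine le_trans (le_of_eq ?_) ((hsummable (l + 1)).le_tsum l fun k _ =>
      mul_nonneg (hw0 k).le (pow_nonneg (hμ k).le _))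
    rw [h3 _ (by omega)]
    have := hμ l
    simp only [hw, hM]
    rw [pow_succ 2]
    field_simp
  · rw [← Real.norm_eq_abs, ← norm_iteratedFDeriv_eq_norm_iteratedDeriv, hH, h3 n hn]
    exact tsum_of_norm_bounded (hasSum_geometric_two' (M n)) fun k => hfb n k x
  · rw [iteratedDeriv, hH, ContinuousMultilinearMap.tsum_eval (hsF n 0)]
    have : ∀ k, iteratedFDeriv ℝ n (f k) 0 (fun _ => 1) =
        w k * μ (k + 1) ^ n * iteratedDeriv n Real.sin 0 := fun k => by
      rw [← iteratedDeriv, hfd, mul_zero]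
    simp only [this]
    rw [tsum_mul_right]
    split_ifs with hn
    · rw [Real.iteratedDeriv_sin_zero_of_even hn]; simp
    · rw [Real.iteratedDeriv_sin_zero_of_odd (Nat.not_even_iff_odd.1 hn), mul_comm]

/-! ### Signs and parity in the Faà di Bruno formula -/

/-- For odd numbers, halving amounts to `(n - 1) / 2`, and `(r - 1) + ∑ (k i - 1) = n - 1`. Hence
the signs in a term multiply to one depending on `n` alone. -/
theorem sum_div_two_of_odd {r : ℕ} (hr : Odd r) (k : Fin r → ℕ) (hk : ∀ i, Odd (k i)) :
    Odd (∑ i, k i) ∧ r / 2 + ∑ i, k i / 2 = (∑ i, k i) / 2 := by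
  have h1 : ∑ i, k i = 2 * ∑ i, k i / 2 + r := by
    have : ∀ i, k i = 2 * (k i / 2) + 1 := fun i => by
      obtain ⟨c, hc⟩ := hk i; omega
    conv_lhs => rw [Finset.sum_congr rfl fun i _ => this i]
    simp [Finset.sum_add_distrib, Finset.mul_sum]
  obtain ⟨c, hc⟩ := hr
  refine ⟨⟨∑ i, k i / 2 + c, by omega⟩, by omega⟩

/-- Multiplication of the signs of the Taylor coefficients of odd functions. -/
theorem sign_mul_prod_sign {a b : ℕ → ℝ} (ha : ∀ n, Even n → a n = 0) (hb : ∀ n, Even n → b n = 0)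
    {n : ℕ} (c : OrderedFinpartition n) :
    ((-1) ^ (c.length / 2) * a c.length) * ∏ j, ((-1) ^ (c.partSize j / 2) * b (c.partSize j)) =
      (-1) ^ (n / 2) * (a c.length * ∏ j, b (c.partSize j)) := by
  by_cases hr : Odd c.length
  · by_cases hk : ∀ j, Odd (c.partSize j)
    · have h := (sum_div_two_of_odd hr c.partSize hk).2
      rw [c.sum_partSize] at h
      rw [Finset.prod_mul_distrib, Finset.prod_pow_eq_pow_sum, ← h, pow_add]
      ring
    · obtain ⟨j, hj⟩ := not_forall.1 hk
      have hz := hb _ (Nat.not_odd_iff_even.1 hj)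
      rw [Finset.prod_eq_zero (Finset.mem_univ j) (by rw [hz, mul_zero]),
        Finset.prod_eq_zero (Finset.mem_univ j) hz]
      simp
  · have hz := ha _ (Nat.not_odd_iff_even.1 hr)
    rw [hz]
    simp

theorem sum_orderedFinpartition_eq_zero_of_even {a b : ℕ → ℝ} (ha : ∀ n, Even n → a n = 0)
    (hb : ∀ n, Even n → b n = 0) {n : ℕ} (hn : Even n) :
    ∑ c : OrderedFinpartition n, a c.length * ∏ j, b (c.partSize j) = 0 := by
  refine Finset.sum_eq_zero fun c _ => ?_
  by_cases hr : Odd c.length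
  · by_cases hk : ∀ j, Odd (c.partSize j)
    · have h := (sum_div_two_of_odd hr c.partSize hk).1
      rw [c.sum_partSize] at h
      exact absurd hn (Nat.not_even_iff_odd.2 h)
    · obtain ⟨j, hj⟩ := not_forall.1 hk
      rw [Finset.prod_eq_zero (Finset.mem_univ j) (hb _ (Nat.not_odd_iff_even.1 hj)), mul_zero]
  · rw [ha _ (Nat.not_odd_iff_even.1 hr), zero_mul]

theorem prod_pow_mul_factorial_div {m : ℕ → ℝ} {r : ℕ} (k : Fin r → ℕ) (c : ℝ) :
    ∏ i, (((k i).factorial : ℝ) * m (k i) / c ^ k i) / (k i).factorial =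
      (∏ i, m (k i)) / c ^ (∑ i, k i) := by
  rw [← Finset.prod_pow_eq_pow_sum, ← Finset.prod_div_distrib]
  refine Finset.prod_congr rfl fun i _ => ?_
  field_simp

/-- If the odd Taylor coefficients of `H` compose into a sequence of class `E^m`, then the weight
has the odd Faà di Bruno property. -/
theorem isOddFdB_of_le {m : ℕ → ℝ} (hm : ∀ n, 1 ≤ n → 0 < m n) {C ρ c : ℝ} (hC : 1 ≤ C)
    (hρ : 1 ≤ ρ) (hc : 1 ≤ c)
    (h : ∀ r, Odd r → ∀ k : Fin r → ℕ, (∀ i, Odd (k i)) →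
      (m r / c ^ r) * ((∏ i, m (k i)) / c ^ (∑ i, k i)) ≤
        C * ρ ^ (∑ i, k i) * m (∑ i, k i)) : IsOddFdB m := by
  refine ⟨C * ρ * c ^ 2, ?_, fun r hr k hk => ?_⟩
  · exact one_le_mul_of_one_le_of_one_le (one_le_mul_of_one_le_of_one_le hC hρ) (one_le_pow₀ hc)
  have h1 := h r hr k hk
  set n := ∑ i, k i with hn
  have hrn : r ≤ n := by
    have := Finset.sum_le_sum fun i (_ : i ∈ (univ : Finset (Fin r))) => Nat.succ_le_of_lt (hk i).pos
    simpa using this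
  have hmn := hm n (hr.pos.trans_le hrn)
  rw [div_mul_div_comm, div_le_iff₀ (by positivity)] at h1
  refine h1.trans ?_
  calc C * ρ ^ n * m n * (c ^ r * c ^ n) ≤ C ^ n * ρ ^ n * m n * (c ^ n * c ^ n) := by
        gcongr
        · exact le_self_pow₀ hC (by have := hr.pos; omega)
    _ = _ := by rw [mul_pow, mul_pow]; ring

/-! ### Transfer between one variable and several -/

section Embedding

variable {m : ℕ → ℝ} {s q : ℕ}

theorem isClassE_single_comp_proj (hm : ∀ n, 1 ≤ n → 0 < m n) {φ : ℝ → ℝ} (hφ : ContDiff ℝ ∞ φ)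
    {C : ℝ} (hC : 1 ≤ C) (hb : ∀ n, 1 ≤ n → ∀ x, |iteratedDeriv n φ x| ≤ C * (n.factorial * m n))
    (j : Fin s) (i : Fin q) :
    IsClassE m (fun x => EuclideanSpace.single i (φ (x j))) Set.univ := by
  set P : EuclideanSpace ℝ (Fin s) →L[ℝ] ℝ := EuclideanSpace.proj j with hP
  set S : ℝ →L[ℝ] EuclideanSpace ℝ (Fin q) :=
    ContinuousLinearMap.toSpanSingleton ℝ (EuclideanSpace.single i (1 : ℝ)) with hS
  have heq : (fun x : EuclideanSpace ℝ (Fin s) => EuclideanSpace.single i (φ (x j))) =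
      S ∘ (φ ∘ P) := by
    ext x l
    simp [hS, hP]
  have hPn : ‖P‖ ≤ 1 := P.opNorm_le_bound zero_le_one fun x => by
    simpa [hP] using PiLp.norm_apply_le x j
  have hSn : ‖S‖ ≤ 1 := by simp [hS]
  have hφP : ContDiff ℝ ∞ (φ ∘ P) := hφ.comp P.contDiff
  rw [heq, isClassE_iff hm]
  refine ⟨(S.contDiff.comp hφP).contDiffOn, fun a _ => ⟨Set.univ, Filter.univ_mem, subset_rfl,
    C, 1, hC, le_rfl, fun x _ n hn => ?_⟩⟩
  rw [one_pow, mul_one]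
  refine le_trans ?_ (hb n hn (P x))
  have h1 := S.norm_iteratedFDeriv_comp_left (n := n) (hφP.contDiffAt (x := x))
    (by exact_mod_cast le_top)
  have h2 : ‖iteratedFDeriv ℝ n (φ ∘ P) x‖ ≤ |iteratedDeriv n φ (P x)| := by
    rw [P.iteratedFDeriv_comp_right hφ x (by exact_mod_cast le_top), ← Real.norm_eq_abs,
      ← norm_iteratedFDeriv_eq_norm_iteratedDeriv]
    refine (ContinuousMultilinearMap.norm_compContinuousLinearMap_le _ _).trans ?_
    refine mul_le_of_le_one_right (norm_nonneg _) ?_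
    simpa using pow_le_one₀ (norm_nonneg _) hPn
  exact h1.trans ((mul_le_of_le_one_left (norm_nonneg _) hSn).trans h2)

theorem IsClassE.exists_iteratedDeriv_le (hm : ∀ n, 1 ≤ n → 0 < m n)
    {F : EuclideanSpace ℝ (Fin s) → EuclideanSpace ℝ (Fin q)}
    {Ω : Set (EuclideanSpace ℝ (Fin s))} (hΩ : IsOpen Ω) (hF : IsClassE m F Ω)
    (h0 : (0 : EuclideanSpace ℝ (Fin s)) ∈ Ω) (j : Fin s) (i : Fin q) :
    ContDiffAt ℝ ∞ (fun t : ℝ => F (EuclideanSpace.single j t) i) 0 ∧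
    ∃ C ρ : ℝ, 1 ≤ C ∧ 1 ≤ ρ ∧ ∀ n, 1 ≤ n →
      |iteratedDeriv n (fun t : ℝ => F (EuclideanSpace.single j t) i) 0| ≤
        C * ρ ^ n * (n.factorial * m n) := by
  rw [isClassE_iff hm] at hF
  obtain ⟨hFs, hFb⟩ := hF
  obtain ⟨U, hU, -, C, ρ, hC, hρ, hb⟩ := hFb 0 h0
  set P : EuclideanSpace ℝ (Fin q) →L[ℝ] ℝ := EuclideanSpace.proj i with hP
  set S : ℝ →L[ℝ] EuclideanSpace ℝ (Fin s) :=
    ContinuousLinearMap.toSpanSingleton ℝ (EuclideanSpace.single j (1 : ℝ)) with hS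
  have heq : (fun t : ℝ => F (EuclideanSpace.single j t) i) = P ∘ (F ∘ S) := by
    ext t
    have : S t = EuclideanSpace.single j t := by
      ext l
      simp [hS]
    simp [hP, this]
  have hPn : ‖P‖ ≤ 1 := P.opNorm_le_bound zero_le_one fun x => by
    simpa [hP] using PiLp.norm_apply_le x i
  have hSn : ‖S‖ ≤ 1 := by simp [hS]
  have hS0 : S 0 = 0 := map_zero S
  have hF0 : ContDiffAt ℝ ∞ F (S 0) := by rw [hS0]; exact hFs.contDiffAt (hΩ.mem_nhds h0)
  have hFS : ContDiffAt ℝ ∞ (F ∘ S) 0 := hF0.comp 0 S.contDiff.contDiffAt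
  rw [heq]
  refine ⟨P.contDiff.contDiffAt.comp 0 hFS, C, ρ, hC, hρ, fun n hn => ?_⟩
  have hopen : IsOpen (S ⁻¹' Ω) := hΩ.preimage S.continuous
  have h0' : S 0 ∈ Ω := by rwa [hS0]
  rw [← Real.norm_eq_abs, ← norm_iteratedFDeriv_eq_norm_iteratedDeriv]
  refine (P.norm_iteratedFDeriv_comp_left hFS (by exact_mod_cast le_top)).trans ?_
  refine (mul_le_of_le_one_left (norm_nonneg _) hPn).trans ?_
  rw [← iteratedFDerivWithin_of_isOpen n hopen h0', S.iteratedFDerivWithin_comp_right hFs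
    hΩ.uniqueDiffOn hopen.uniqueDiffOn h0' (by exact_mod_cast le_top)]
  refine (ContinuousMultilinearMap.norm_compContinuousLinearMap_le _ _).trans ?_
  refine (mul_le_of_le_one_right (norm_nonneg _) ?_).trans ?_
  · simpa using pow_le_one₀ (norm_nonneg _) hSn
  · rw [iteratedFDerivWithin_of_isOpen n hΩ h0', hS0]
    exact hb 0 (mem_of_mem_nhds hU) n hn

end Embedding

/-! ### Necessity of FdB -/

theorem CompositionClosed.isOddFdB {m : ℕ → ℝ} (hm : WeaklyLogConvex m) {s p q : ℕ} (hs : 1 ≤ s)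
    (hp : 1 ≤ p) (hq : 1 ≤ q) (h : CompositionClosed m s p q) : IsOddFdB m := by
  have hpos := fun n => hm.pos (n := n)
  obtain ⟨H, η, hH, hη0, hηe, hηo, hHb, hHη⟩ := hm.exists_characteristic
  have hcl : ∀ (a b : ℕ) (j : Fin a) (i : Fin b),
      IsClassE m (fun x => EuclideanSpace.single i (H (x j))) Set.univ := fun a b j i =>
    isClassE_single_comp_proj hpos hH le_rfl (by simpa using hHb) j i
  have hcomp := h Set.univ Set.univ _ _ isOpen_univ isOpen_univ (Set.mapsTo_univ _ _)
    (hcl s p ⟨0, hs⟩ ⟨0, hp⟩) (hcl p q ⟨0, hp⟩ ⟨0, hq⟩)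
  obtain ⟨-, C, ρ, hC, hρ, hb⟩ := hcomp.exists_iteratedDeriv_le hpos isOpen_univ (Set.mem_univ _)
    ⟨0, hs⟩ ⟨0, hq⟩
  have hfun : (fun t : ℝ => (((fun x : EuclideanSpace ℝ (Fin p) =>
      (EuclideanSpace.single ⟨0, hq⟩ (H (x ⟨0, hp⟩)) : EuclideanSpace ℝ (Fin q))) ∘
      fun x : EuclideanSpace ℝ (Fin s) =>
        (EuclideanSpace.single ⟨0, hp⟩ (H (x ⟨0, hs⟩)) : EuclideanSpace ℝ (Fin p)))
      (EuclideanSpace.single ⟨0, hs⟩ t)) ⟨0, hq⟩) = H ∘ H := by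
    ext t
    simp
  rw [hfun] at hb
  have hH0 : H 0 = 0 := by
    have := hHη 0
    rw [hηe 0 (by simp)] at this
    simpa using this
  refine isOddFdB_of_le hpos hC hρ one_le_two fun r hr k hk => ?_
  set n := ∑ i, k i with hn
  have hn1 : 1 ≤ n := (sum_div_two_of_odd hr k hk).1.pos
  have h1 := hb n hn1
  rw [iteratedDeriv_comp_eq_sum_orderedFinpartition (n := ∞) hH.contDiffAt hH.contDiffAt
    (by exact_mod_cast le_top)] at h1
  -- All terms now carry the common sign `(-1) ^ (n / 2)`, so the absolute value of the sum is the
  -- sum of nonnegative terms.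
  simp only [hH0, hHη, sign_mul_prod_sign hηe hηe] at h1
  rw [← Finset.mul_sum, abs_mul, abs_pow, abs_neg, abs_one, one_pow, one_mul] at h1
  have h2 := (le_sum_orderedFinpartition hη0 hη0 hr.pos k fun i => (hk i).pos).trans
    ((le_abs_self _).trans h1)
  have h3 : (m r / 2 ^ r) * ((∏ i, m (k i)) / 2 ^ (∑ i, k i)) ≤
      η r / r.factorial * ∏ i, η (k i) / (k i).factorial := by
    rw [← prod_pow_mul_factorial_div]
    have hmk : ∀ i, 0 < m (k i) := fun i => hpos _ (hk i).pos
    have hη := hη0 r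
    refine mul_le_mul ?_ (Finset.prod_le_prod (fun i _ => ?_) fun i _ => ?_)
      (Finset.prod_nonneg fun i _ => ?_) (by positivity)
    · rw [le_div_iff₀ (by positivity)]
      refine le_trans (le_of_eq ?_) (hηo r hr)
      ring
    · have := hmk i; positivity
    · have := hηo _ (hk i); gcongr
    · have := hmk i; positivity
  have hfac : (0 : ℝ) < n.factorial := by positivity
  refine h3.trans (le_of_mul_le_mul_left (h2.trans_eq ?_) hfac)
  ring

/-- The signed Taylor coefficients at `0` of a solution of `f = id + ψ ∘ f`, for `ψ` with
alternating odd Taylor coefficients, are nonnegative and bounded below by those of `ψ ∘ f`. -/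
theorem exists_signed_coeff {η F : ℕ → ℝ} (hη0 : ∀ n, 0 ≤ η n) (hηe : ∀ n, Even n → η n = 0)
    (hη1 : η 1 = 0) (hF0 : F 0 = 0)
    (hF : ∀ n, 1 ≤ n → F n = (if n = 1 then 1 else 0) + ∑ c : OrderedFinpartition n,
      ((-1) ^ (c.length / 2) * η c.length) * ∏ j, F (c.partSize j)) :
    ∃ b : ℕ → ℝ, (∀ n, 0 ≤ b n) ∧ (∀ n, F n = (-1) ^ (n / 2) * b n) ∧ b 1 = 1 ∧
      ∀ r, 1 ≤ r → ∀ k : Fin r → ℕ, (∀ i, 1 ≤ k i) →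
        (∑ i, k i).factorial * (η r / r.factorial * ∏ i, b (k i) / (k i).factorial) ≤
          b (∑ i, k i) := by
  have hsq : ∀ n : ℕ, ((-1 : ℝ) ^ (n / 2)) * (-1) ^ (n / 2) = 1 := fun n => by
    rw [← mul_pow]; norm_num
  set b : ℕ → ℝ := fun n => (-1) ^ (n / 2) * F n with hb
  have hFb : ∀ n, F n = (-1) ^ (n / 2) * b n := fun n => by
    rw [hb]; simp only; rw [← mul_assoc, hsq, one_mul]
  have hrec : ∀ n, 1 ≤ n → ∀ b' : ℕ → ℝ, (∀ n, Even n → b' n = 0) → (∀ k < n, b k = b' k) →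
      b n = (if n = 1 then 1 else 0) +
        ∑ c : OrderedFinpartition n, η c.length * ∏ j, b' (c.partSize j) := by
    intro n hn b' hb'e hb'
    have h1 := sum_orderedFinpartition_congr_of_lt (a := fun n => (-1) ^ (n / 2) * η n) (b := F)
      (b' := fun n => (-1) ^ (n / 2) * b' n) (by simp [hη1]) hn
      (fun k hk => by rw [hFb, hb' k hk])
    have h2 := hF n hn
    rw [h1] at h2
    simp only [sign_mul_prod_sign hηe hb'e] at h2
    rw [← Finset.mul_sum] at h2
    simp only [hb, h2]
    rw [mul_add, ← mul_assoc, hsq, one_mul]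
    split_ifs with h
    · subst h; simp
    · simp
  have hclaim : ∀ n, 0 ≤ b n ∧ (Even n → b n = 0) := by
    intro n
    induction n using Nat.strong_induction_on with
    | _ n ih =>
    rcases Nat.eq_zero_or_pos n with rfl | hn
    · simp [hb, hF0]
    -- Parity and nonnegativity are known only below `n`; extending by zero makes them hold at all
    -- indices without changing the recursion.
    set b' : ℕ → ℝ := fun k => if k < n then b k else 0 with hb'
    have hb'e : ∀ k, Even k → b' k = 0 := fun k hk => by
      simp only [hb']
      split_ifs with h
      exacts [(ih k h).2 hk, rfl]
    have hb'0 : ∀ k, 0 ≤ b' k := fun k => by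
      simp only [hb']
      split_ifs with h
      exacts [(ih k h).1, le_rfl]
    rw [hrec n hn b' hb'e fun k hk => (if_pos hk).symm]
    refine ⟨add_nonneg (by split_ifs <;> norm_num) (Finset.sum_nonneg fun c _ =>
      mul_nonneg (hη0 _) (Finset.prod_nonneg fun j _ => hb'0 _)), fun he => ?_⟩
    rw [sum_orderedFinpartition_eq_zero_of_even hηe hb'e he, add_zero, if_neg]
    rintro rfl
    exact absurd he (by decide)
  have hrec' := fun n hn => hrec n hn b (fun n => (hclaim n).2) fun _ _ => rfl
  refine ⟨b, fun n => (hclaim n).1, hFb, ?_, fun r hr k hk => ?_⟩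
  · rw [hrec' 1 le_rfl, if_pos rfl, add_eq_left]
    refine Finset.sum_eq_zero fun c _ => ?_
    have h : c.length = 1 := le_antisymm c.length_le (c.length_pos one_pos)
    have hz : η c.length = 0 := by rw [h, hη1]
    rw [hz, zero_mul]
  · have hrn : 1 ≤ ∑ i, k i := by
      have := Finset.sum_le_sum fun i (_ : i ∈ (univ : Finset (Fin r))) => hk i
      exact hr.trans (by simpa using this)
    refine (le_sum_orderedFinpartition hη0 (fun n => (hclaim n).1) hr k hk).trans ?_
    rw [hrec' _ hrn]
    exact le_add_of_nonneg_left (by split_ifs <;> norm_num)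

theorem IsClassE.id_add {m : ℕ → ℝ} (hm : ∀ n, 1 ≤ n → 0 < m n) {d : ℕ}
    {F : EuclideanSpace ℝ (Fin d) → EuclideanSpace ℝ (Fin d)} (hF : IsClassE m F Set.univ) :
    IsClassE m (fun x => x + F x) Set.univ := by
  rw [isClassE_iff hm] at hF ⊢
  obtain ⟨hFs, hFb⟩ := hF
  refine ⟨contDiffOn_id.add hFs, fun a ha => ?_⟩
  obtain ⟨U, hU, hUΩ, C, ρ, hC, hρ, hb⟩ := hFb a ha
  have hm1 := hm 1 le_rfl
  refine ⟨U, hU, hUΩ, C + 1 / m 1, ρ, hC.trans (le_add_of_nonneg_right (by positivity)), hρ,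
    fun x hx n hn => ?_⟩
  have hFx : ContDiffAt ℝ ∞ F x := hFs.contDiffAt Filter.univ_mem
  have heq : (fun x => x + F x) = (ContinuousLinearMap.id ℝ (EuclideanSpace ℝ (Fin d)) :
    EuclideanSpace ℝ (Fin d) → EuclideanSpace ℝ (Fin d)) + F := rfl
  rw [heq, iteratedFDeriv_add_apply (ContinuousLinearMap.id ℝ _).contDiff.contDiffAt
    (hFx.of_le (by exact_mod_cast le_top))]
  have hmn := hm n hn
  have hid : ‖iteratedFDeriv ℝ n (ContinuousLinearMap.id ℝ (EuclideanSpace ℝ (Fin d))) x‖ ≤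
      1 / m 1 * ρ ^ n * (n.factorial * m n) := by
    rcases hn.eq_or_lt with rfl | hn
    · rw [norm_iteratedFDeriv_one, ContinuousLinearMap.fderiv]
      refine ContinuousLinearMap.norm_id_le.trans ?_
      rw [pow_one, Nat.factorial_one, Nat.cast_one, one_mul]
      calc 1 ≤ ρ := hρ
        _ = 1 / m 1 * ρ * m 1 := by field_simp
    · rw [iteratedFDeriv_clm_of_two_le _ hn, norm_zero]
      positivity
  refine (norm_add_le _ _).trans ((add_le_add hid (hb x hx n hn)).trans_eq ?_)
  ring

theorem exists_contDiffOn_localInverse {E : Type*} [NormedAddCommGroup E] [NormedSpace ℝ E]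
    [CompleteSpace E] {g : E → E} (hg : ContDiff ℝ ∞ g) {a : E}
    (ha : HasFDerivAt g (ContinuousLinearMap.id ℝ E) a) :
    ∃ e : OpenPartialHomeomorph E E, a ∈ e.source ∧ (∀ x, e x = g x) ∧
      ContDiffOn ℝ ∞ e.symm e.target := by
  have ha' : HasFDerivAt g ((ContinuousLinearEquiv.refl ℝ E : E ≃L[ℝ] E) : E →L[ℝ] E) a := ha
  set e₀ := (hg.contDiffAt (x := a)).toOpenPartialHomeomorph g ha' (by simp) with he₀
  -- Restricting to points with invertible derivative makes the inverse smooth on its whole target,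
  -- not just near the image of `a`.
  set O : Set E := fderiv ℝ g ⁻¹' Set.range ((↑) : (E ≃L[ℝ] E) → E →L[ℝ] E) with hO
  have hOo : IsOpen O := ContinuousLinearEquiv.isOpen.preimage (hg.continuous_fderiv (by simp))
  have haO : a ∈ O := ⟨ContinuousLinearEquiv.refl ℝ E, ha'.fderiv.symm⟩
  have hcoe : ∀ x, e₀.restrOpen O hOo x = g x := fun x => rfl
  refine ⟨e₀.restrOpen O hOo, ?_, hcoe, fun y hy => ?_⟩
  · rw [OpenPartialHomeomorph.restrOpen_source]
    exact ⟨(hg.contDiffAt (x := a)).mem_toOpenPartialHomeomorph_source ha' (by simp), haO⟩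
  · have hx := (e₀.restrOpen O hOo).map_target hy
    rw [OpenPartialHomeomorph.restrOpen_source] at hx
    obtain ⟨L, hL⟩ := hx.2
    refine (OpenPartialHomeomorph.contDiffAt_symm (f₀' := L) _ hy ?_ ?_).contDiffWithinAt
    · have h : HasFDerivAt g (fderiv ℝ g ((e₀.restrOpen O hOo).symm y))
        ((e₀.restrOpen O hOo).symm y) := (hg.differentiable (by simp) _).hasFDerivAt
      rw [← hL] at h
      exact h
    · exact hg.contDiffAt

theorem InversionClosed.isOddFdB {m : ℕ → ℝ} (hm : WeaklyLogConvex m) {d : ℕ} (hd : 1 ≤ d)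
    (h : InversionClosed m d) : IsOddFdB m := by
  have hpos := fun n => hm.pos (n := n)
  have hm1 := hpos 1 le_rfl
  obtain ⟨H, η, hH, hη0, hηe, hηo, hHb, hHη⟩ := hm.exists_characteristic
  -- Without its linear part, `ψ` has zero derivative at `0`: the map `g` below is tangent to the
  -- identity, and along the chosen axis its inverse satisfies `f = id + ψ ∘ f`, a recursion with
  -- the favourable signs.
  set ψ : ℝ → ℝ := fun x => H x - η 1 * x with hψ
  have hlin : ContDiff ℝ ∞ fun x : ℝ => η 1 * x := contDiff_const.mul contDiff_id
  have hψs : ContDiff ℝ ∞ ψ := hH.sub hlin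
  have hψd : ∀ n, 1 ≤ n → ∀ x, iteratedDeriv n ψ x =
      iteratedDeriv n H x - if n = 1 then η 1 else 0 := fun n hn x => by
    have h1 : iteratedDeriv n ψ x = iteratedDeriv n H x - iteratedDeriv n (fun x => η 1 * x) x :=
      iteratedDeriv_fun_sub (hH.contDiffAt.of_le (by exact_mod_cast le_top))
        (hlin.contDiffAt.of_le (by exact_mod_cast le_top))
    rw [h1, iteratedDeriv_const_mul_field, iteratedDeriv_fun_id]
    congr 1
    split_ifs <;> simp_all
  have hH0 : H 0 = 0 := by simpa [hηe 0 (by simp)] using hHη 0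
  have hψ0 : ψ 0 = 0 := by simp [hψ, hH0]
  set η' : ℕ → ℝ := fun n => if n = 1 then 0 else η n with hη'
  have hψη : ∀ n, 1 ≤ n → iteratedDeriv n ψ 0 = (-1) ^ (n / 2) * η' n := fun n hn => by
    rw [hψd n hn, hHη]
    simp only [hη']
    split_ifs with h
    · subst h; simp
    · simp
  have hψb : ∀ n, 1 ≤ n → ∀ x, |iteratedDeriv n (fun x => -ψ x) x| ≤
      (1 + η 1 / m 1) * (n.factorial * m n) := fun n hn x => by
    have hmn := hpos n hn
    rw [iteratedDeriv_fun_neg, abs_neg, hψd n hn]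
    refine (abs_sub _ _).trans ?_
    rw [add_mul, one_mul]
    refine add_le_add (hHb n hn x) ?_
    have := hη0 1
    split_ifs with h
    · subst h
      rw [abs_of_nonneg this, Nat.factorial_one, Nat.cast_one, one_mul, div_mul_cancel₀ _ hm1.ne']
    · rw [abs_zero]; positivity
  set i₀ : Fin d := ⟨0, hd⟩
  set g : EuclideanSpace ℝ (Fin d) → EuclideanSpace ℝ (Fin d) :=
    fun x => x + EuclideanSpace.single i₀ (-ψ (x i₀)) with hg
  have hgE : IsClassE m g Set.univ := (isClassE_single_comp_proj hpos hψs.neg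
    (le_add_of_nonneg_right (div_nonneg (hη0 1) hm1.le)) hψb i₀ i₀).id_add hpos
  have hgs : ContDiff ℝ ∞ g := contDiffOn_univ.1 hgE.1
  have hg0 : g 0 = 0 := by simp [hg, hψ0]
  have hgd : HasFDerivAt g (ContinuousLinearMap.id ℝ (EuclideanSpace ℝ (Fin d))) 0 := by
    have h1 : HasDerivAt ψ 0 0 := by
      have h2 := hψη 1 le_rfl
      rw [iteratedDeriv_one] at h2
      simp only [hη', if_pos, mul_zero] at h2
      have h3 := (hψs.differentiable (by simp) 0).hasDerivAt
      rwa [h2] at h3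
    have h2 : HasFDerivAt (fun x : EuclideanSpace ℝ (Fin d) => ψ (x i₀))
        ((0 : ℝ) • (EuclideanSpace.proj i₀ : EuclideanSpace ℝ (Fin d) →L[ℝ] ℝ)) 0 :=
      HasDerivAt.comp_hasFDerivAt (h₂ := ψ)
        (f := (EuclideanSpace.proj i₀ : EuclideanSpace ℝ (Fin d) →L[ℝ] ℝ)) 0 h1
        (ContinuousLinearMap.hasFDerivAt _)
    set S : ℝ →L[ℝ] EuclideanSpace ℝ (Fin d) :=
      ContinuousLinearMap.toSpanSingleton ℝ (EuclideanSpace.single i₀ (1 : ℝ)) with hS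
    have h3 := (hasFDerivAt_id (𝕜 := ℝ) (0 : EuclideanSpace ℝ (Fin d))).add
      (S.hasFDerivAt.comp 0 h2.neg)
    have heq : g = id + (S : ℝ → EuclideanSpace ℝ (Fin d)) ∘
        (-fun x : EuclideanSpace ℝ (Fin d) => ψ (x i₀)) := by
      ext x l
      simp only [hg, hS, PiLp.add_apply, PiLp.single_apply, Pi.add_apply, id_eq,
        Function.comp_apply, Pi.neg_apply, ContinuousLinearMap.toSpanSingleton_apply,
        PiLp.smul_apply, smul_eq_mul, mul_ite, mul_one, mul_zero]
    rw [heq]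
    exact h3.congr_fderiv (by
      rw [zero_smul, neg_zero, ContinuousLinearMap.comp_zero, add_zero])
  obtain ⟨e, he0, heg, hes⟩ := exists_contDiffOn_localInverse hgs hgd
  have hE := h Set.univ g e isOpen_univ hgE (Set.subset_univ _) (fun x _ => heg x) hes
  have h0t : (0 : EuclideanSpace ℝ (Fin d)) ∈ e.target := by
    have := e.map_source he0
    rwa [heg, hg0] at this
  have he00 : e.symm 0 = 0 := by
    have := e.left_inv he0
    rwa [heg, hg0] at this
  obtain ⟨hfs, C, ρ, hC, hρ, hfb⟩ := hE.exists_iteratedDeriv_le hpos e.open_target h0t i₀ i₀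
  set f : ℝ → ℝ := fun t => e.symm (EuclideanSpace.single i₀ t) i₀ with hf
  have hs0 : (EuclideanSpace.single i₀ (0 : ℝ) : EuclideanSpace ℝ (Fin d)) = 0 := by
    ext l
    simp
  have hf0 : f 0 = 0 := by simp only [hf, hs0, he00, PiLp.zero_apply]
  have hcont : Continuous fun t : ℝ => (EuclideanSpace.single i₀ t : EuclideanSpace ℝ (Fin d)) := by
    have : (fun t : ℝ => (EuclideanSpace.single i₀ t : EuclideanSpace ℝ (Fin d))) =
        ContinuousLinearMap.toSpanSingleton ℝ (EuclideanSpace.single i₀ (1 : ℝ)) := by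
      ext t l
      simp
    rw [this]
    exact ContinuousLinearMap.continuous _
  have hfe : f =ᶠ[𝓝 0] id + ψ ∘ f := by
    have h0 : (EuclideanSpace.single i₀ (0 : ℝ) : EuclideanSpace ℝ (Fin d)) ∈ e.target := by
      rwa [hs0]
    filter_upwards [hcont.continuousAt.preimage_mem_nhds (e.open_target.mem_nhds h0)] with t ht
    have h1 := e.right_inv ht
    rw [heg] at h1
    have h2 := congrArg (fun x : EuclideanSpace ℝ (Fin d) => x i₀) h1
    simp only [hg, PiLp.add_apply, PiLp.single_apply, if_true] at h2
    simp only [hf, Pi.add_apply, id_eq, Function.comp_apply]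
    linarith
  have hψf : ContDiffAt ℝ ∞ ψ (f 0) := hψs.contDiffAt
  obtain ⟨b, hb0, hFb, hb1, hblow⟩ := exists_signed_coeff (η := η')
    (F := fun n => iteratedDeriv n f 0)
    (fun n => by simp only [hη']; split_ifs; exacts [le_rfl, hη0 n])
    (fun n hn => by simp only [hη']; split_ifs; exacts [rfl, hηe n hn])
    (by simp [hη']) (by simp [hf0])
    (fun n hn => by
      rw [(hfe.iteratedDeriv_eq n), iteratedDeriv_add contDiffAt_id
        ((hψf.comp 0 hfs).of_le (by exact_mod_cast le_top)), iteratedDeriv_id,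
        iteratedDeriv_comp_eq_sum_orderedFinpartition (n := ∞) hψf hfs
          (by exact_mod_cast le_top), if_neg (by omega)]
      congr 1
      refine Finset.sum_congr rfl fun c _ => ?_
      rw [hf0, hψη _ (c.length_pos hn)])
  -- The `2` matches the lower bound on `η`; `m 1` is needed for `k = 1`, where the coefficient of
  -- the inverse is `1` instead of being bounded below by `η`.
  set c := max 2 (m 1) with hc
  have hc2 : 2 ≤ c := le_max_left _ _
  have hc1 : 1 ≤ c := one_le_two.trans hc2
  have hη'o : ∀ r, Odd r → 3 ≤ r → m r / c ^ r ≤ η' r / r.factorial := fun r hr h3 => by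
    have hmr := hpos r (by omega)
    have h1 := hηo r hr
    have h2 : η' r = η r := if_neg (by omega)
    rw [h2, le_div_iff₀ (by positivity)]
    calc m r / c ^ r * r.factorial ≤ m r / 2 ^ r * r.factorial := by gcongr
      _ = r.factorial * m r / 2 ^ r := by ring
      _ ≤ η r := h1
  have hbk : ∀ k, Odd k → m k / c ^ k ≤ b k / k.factorial := fun k hk => by
    by_cases h3 : 3 ≤ k
    · have h1 := hblow k (by omega) (fun _ => 1) (fun _ => le_rfl)
      simp only [hb1, Finset.sum_const, Finset.card_univ, Fintype.card_fin, smul_eq_mul, mul_one,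
        Nat.factorial_one, Nat.cast_one, div_one, Finset.prod_const_one] at h1
      refine (hη'o k hk h3).trans ?_
      rw [le_div_iff₀ (by positivity), mul_comm]
      exact h1
    · obtain rfl : k = 1 := by obtain ⟨l, rfl⟩ := hk; omega
      rw [hb1, pow_one, Nat.factorial_one, Nat.cast_one, div_one, div_le_one (by linarith)]
      exact le_max_right _ _
  refine isOddFdB_of_le hpos hC hρ hc1 fun r hr k hk => ?_
  have hmk : ∀ i, 0 < m (k i) := fun i => hpos _ (hk i).pos
  by_cases h3 : 3 ≤ r
  · have h1 := hblow r hr.pos k fun i => (hk i).pos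
    have hn1 : 1 ≤ ∑ i, k i := (sum_div_two_of_odd hr k hk).1.pos
    have h2 := hfb _ hn1
    have h4 : b (∑ i, k i) = |iteratedDeriv (∑ i, k i) f 0| := by
      have := hFb (∑ i, k i)
      rw [this, abs_mul, abs_pow, abs_neg, abs_one, one_pow, one_mul, abs_of_nonneg (hb0 _)]
    rw [← h4] at h2
    have h5 : (m r / c ^ r) * ((∏ i, m (k i)) / c ^ (∑ i, k i)) ≤
        η' r / r.factorial * ∏ i, b (k i) / (k i).factorial := by
      rw [← prod_pow_mul_factorial_div]
      refine mul_le_mul (hη'o r hr h3) (Finset.prod_le_prod (fun i _ => ?_) fun i _ => ?_)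
        (Finset.prod_nonneg fun i _ => ?_) (le_trans ?_ (hη'o r hr h3))
      · have := hmk i; positivity
      · refine le_trans (le_of_eq ?_) (hbk _ (hk i))
        field_simp
      · have := hmk i; positivity
      · have := hpos r hr.pos; positivity
    have hfac : (0 : ℝ) < (∑ i, k i).factorial := by positivity
    refine h5.trans (le_of_mul_le_mul_left ((h1.trans h2).trans_eq ?_) hfac)
    ring
  -- The linear part was removed, so `η' 1 = 0` gives nothing here; the inequality is elementary
  -- because `m 1 ≤ c`.
  · obtain rfl : r = 1 := by obtain ⟨l, rfl⟩ := hr; omega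
    simp only [Fin.prod_univ_one, Fin.sum_univ_one, pow_one]
    have hm0 := hmk 0
    have h1 : m 1 / c ≤ 1 := by
      rw [div_le_one (by linarith)]; exact le_max_right _ _
    have h2 : m (k 0) / c ^ k 0 ≤ m (k 0) := div_le_self hm0.le (one_le_pow₀ hc1)
    have h3 : 1 ≤ C * ρ ^ k 0 := one_le_mul_of_one_le_of_one_le hC (one_le_pow₀ hρ)
    calc m 1 / c * (m (k 0) / c ^ k 0) ≤ 1 * m (k 0) := by gcongr
      _ ≤ C * ρ ^ k 0 * m (k 0) := by gcongr

theorem mainTheorem4 (m : ℕ → ℝ) (hm : WeaklyLogConvex m)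
    (s p q d : ℕ) (hs : 1 ≤ s) (hp : 1 ≤ p) (hq : 1 ≤ q) (hd : 1 ≤ d) :
    List.TFAE [IsFdB m, CompositionClosed m s p q, InversionClosed m d] := by
  have hpos := fun n => hm.pos (n := n)
  tfae_have 1 → 2 := fun h => h.compositionClosed hpos s p q
  tfae_have 1 → 3 := fun h => (h.isOddFdB.hasGeometricMajorants hm).inversionClosed hpos d
  tfae_have 2 → 1 := fun h => ((h.isOddFdB hm hs hp hq).hasGeometricMajorants hm).isFdB hpos
  tfae_have 3 → 1 := fun h => ((h.isOddFdB hm hd).hasGeometricMajorants hm).isFdB hpos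
  tfae_finish
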